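/- **Theorem 1.5 (Heisenberg).** Let $G$ be the 13-dimensional Heisenberg group, i.e. $\mathbb{R}^6\times\mathbb{R}^6\times\mathbb{R}$ with the multiplication $$(\mathbf{x},\mathbf{y},z)\cdot(\mathbf{x}',\mathbf{y}',z')=(\mathbf{x}+\mathbf{x}',\ \mathbf{y}+\mathbf{y}',\ z+z'+\mathbf{x}^{\mathrm T}\mathbf{y}'-\mathbf{x}'^{\mathrm T}\mathbf{y}),$$ let $\Gamma\subset G$ be the subgroup of integer points, and let $X=G/\Gamma$. Then $X$ is a nilmanifold, that is, $G$ is a simply connected nilpotent Lie group and $\Gamma$ is a cocompact lattice (a discrete subgroup with compact quotient) in $G$; and there exist an action $\alpha$ of $\mathbb{Z}^2$ on $X$ by automorphisms (a group morphism $\mathbf{n}\mapsto\alpha^{\mathbf{n}}$ into the continuous automorphisms of $G$ that map $\Gamma$ onto itself, acting on $X$ by the induced homeomorphisms) and an $\alpha$-invariant Borel probability measure $\mu$ on $X$ such that $\alpha$ has no virtually cyclic algebraic factor other than the trivial one-point factor, and: 1. there is an algebraic factor of $\alpha$ on a torus $X/H\cong\mathbb{T}^d$ such that the factor action is totally irreducible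 and not virtually cyclic, and the projection of $\mu$ to $X/H$ is the Lebesgue measure; 2. $\mu$ is ergodic under the restriction $\alpha|_\Sigma$ of $\alpha$ to every finite index subgroup $\Sigma\subset\mathbb{Z}^2$; 3. for no finite index subgroup $\Sigma\subset\mathbb{Z}^2$ does there exist a non-trivial $\alpha|_\Sigma$-invariant connected closed subgroup $H$ of $G$ such that $\mu$ can be disintegrated into $H$-invariant probability measures on compact $H$-orbits (that is, $\mu=\int\kappa_y\,d\nu(y)$ for a measurable family $\kappa_y$ over a probability space $(Y,\nu)$, where for $\nu$-almost every $y$ the measure $\kappa_y$ is an $H$-invariant probability measure concentrated on a compact orbit $H\cdot p\subset X$, under left translation). Here an *algebraic factor* of $\alpha$ is the action induced by $\alpha$ on $X/H:=G/H\Gamma$, where $H$ is an $\alpha$-invariant normal subgroup of $G$ that is rational, i.e. closed, connected and such that $H\cap\Gamma$ is a cocompact lattice in $H$. A $\mathbb{Z}^2$-action by homeomorphisms is *virtually cyclic* if the torsion-free rank of its image in the group of homeomorphisms is $0$ or $1$. A $\mathbb{Z}^2$-action by automorphisms of $\mathbb{T}^d=\mathbb{R}^d/\mathbb{Z}^d$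 is *totally irreducible* if the restriction to any finite index subgroup leaves invariant no subtorus other than $\{0\}$ and $\mathbb{T}^d$. -/

import Mathlib

open MeasureTheory ProbabilityTheory
open scoped Manifold ContDiff

/-! ## The Heisenberg group and its integer lattice -/

/-- The underlying manifold `ℝⁿ × ℝⁿ × ℝ` of the Heisenberg group. -/
abbrev HeisSpace (n : ℕ) : Type := (Fin n → ℝ) × (Fin n → ℝ) × ℝ

/-- The `(2n+1)`-dimensional Heisenberg group: points `(x, y, z)` of `ℝⁿ × ℝⁿ × ℝ`, with the
multiplication `(x, y, z) (x', y', z') = (x + x', y + y', z + z' + xᵀy' - x'ᵀy)`. -/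
def Heis (n : ℕ) : Type := HeisSpace n

namespace Heis

variable {n : ℕ}

instance : TopologicalSpace (Heis n) := inferInstanceAs (TopologicalSpace (HeisSpace n))

/-- The smooth structure is that of the vector space `ℝⁿ × ℝⁿ × ℝ` (one global chart). -/
instance : ChartedSpace (HeisSpace n) (Heis n) :=
  inferInstanceAs (ChartedSpace (HeisSpace n) (HeisSpace n))

/-- The element `(x, y, z)` of the Heisenberg group. -/
def mk (x y : Fin n → ℝ) (z : ℝ) : Heis n := (x, y, z)

/-- The coordinate `x`. -/
def x (g : Heis n) : Fin n → ℝ := g.1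

/-- The coordinate `y`. -/
def y (g : Heis n) : Fin n → ℝ := g.2.1

/-- The coordinate `z`. -/
def z (g : Heis n) : ℝ := g.2.2

theorem ext' {g h : Heis n} (hx : g.x = h.x) (hy : g.y = h.y) (hz : g.z = h.z) : g = h :=
  Prod.ext hx (Prod.ext hy hz)

instance : Mul (Heis n) :=
  ⟨fun g h => mk (g.x + h.x) (g.y + h.y) (g.z + h.z + g.x ⬝ᵥ h.y - h.x ⬝ᵥ g.y)⟩

instance : One (Heis n) := ⟨mk 0 0 0⟩

instance : Inv (Heis n) := ⟨fun g => mk (-g.x) (-g.y) (-g.z)⟩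

@[simp] theorem mul_x (g h : Heis n) : (g * h).x = g.x + h.x := rfl
@[simp] theorem mul_y (g h : Heis n) : (g * h).y = g.y + h.y := rfl
@[simp] theorem mul_z (g h : Heis n) :
    (g * h).z = g.z + h.z + g.x ⬝ᵥ h.y - h.x ⬝ᵥ g.y := rfl
@[simp] theorem one_x : (1 : Heis n).x = 0 := rfl
@[simp] theorem one_y : (1 : Heis n).y = 0 := rfl
@[simp] theorem one_z : (1 : Heis n).z = 0 := rfl
@[simp] theorem inv_x (g : Heis n) : g⁻¹.x = -g.x := rfl
@[simp] theorem inv_y (g : Heis n) : g⁻¹.y = -g.y := rfl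
@[simp] theorem inv_z (g : Heis n) : g⁻¹.z = -g.z := rfl

instance : Group (Heis n) :=
  Group.ofLeftAxioms
    (fun a b c => ext' (by simp [add_assoc]) (by simp [add_assoc])
      (by simp [add_dotProduct, dotProduct_add]; ring))
    (fun a => ext' (by simp) (by simp) (by simp))
    (fun a => ext' (by simp) (by simp) (by simp))

/-- The lattice of the integer points of the Heisenberg group. -/
def lattice (n : ℕ) : Subgroup (Heis n) where
  carrier := {g | (∀ i, ∃ k : ℤ, g.x i = k) ∧ (∀ i, ∃ k : ℤ, g.y i = k) ∧ ∃ k : ℤ, g.z = k}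
  one_mem' := ⟨fun _ => ⟨0, by simp⟩, fun _ => ⟨0, by simp⟩, ⟨0, by simp⟩⟩
  inv_mem' := by
    rintro g ⟨hx, hy, k, hk⟩
    refine ⟨fun i => ?_, fun i => ?_, ⟨-k, by simp [hk]⟩⟩
    · obtain ⟨m, hm⟩ := hx i
      exact ⟨-m, by simp [hm]⟩
    · obtain ⟨m, hm⟩ := hy i
      exact ⟨-m, by simp [hm]⟩
  mul_mem' := by
    rintro g h ⟨hx, hy, k, hk⟩ ⟨hx', hy', k', hk'⟩
    choose a ha using hx
    choose b hb using hy
    choose a' ha' using hx'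
    choose b' hb' using hy'
    refine ⟨fun i => ⟨a i + a' i, by simp [ha, ha']⟩, fun i => ⟨b i + b' i, by simp [hb, hb']⟩,
      ⟨k + k' + ∑ i, a i * b' i - ∑ i, a' i * b i, ?_⟩⟩
    simp [dotProduct, ha, hb, ha', hb', hk, hk']

end Heis

/-- The Heisenberg nilmanifold `G / Γ` of dimension `2n + 1`. -/
abbrev HeisNil (n : ℕ) : Type := Heis n ⧸ Heis.lattice n

/-- The Heisenberg nilmanifold carries its Borel `σ`-algebra. -/
instance (n : ℕ) : MeasurableSpace (HeisNil n) := borel _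

instance (n : ℕ) : BorelSpace (HeisNil n) := ⟨rfl⟩

/-! ## Lattices, rational subgroups, actions by automorphisms -/

section Invariance

variable {G : Type*} [Group G]

/-- The subgroup `K` is invariant under the automorphisms `α a`, `a ∈ S`: they all map `K` onto
itself. -/
def InvariantUnder {A : Type*} [Group A] (α : A →* MulAut G) (S : Subgroup A)
    (K : Subgroup G) : Prop :=
  ∀ a ∈ S, ∀ g : G, α a g ∈ K ↔ g ∈ K

theorem InvariantUnder.sup {A : Type*} [Group A] {α : A →* MulAut G} {S : Subgroup A}
    {K L : Subgroup G} (hK : InvariantUnder α S K) (hL : InvariantUnder α S L) :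
    InvariantUnder α S (K ⊔ L) := by
  have key : ∀ a ∈ S, ∀ g ∈ K ⊔ L, α a g ∈ K ⊔ L := by
    intro a ha
    have h : K ⊔ L ≤ (K ⊔ L).comap (α a).toMonoidHom :=
      sup_le (fun g hg => Subgroup.mem_sup_left ((hK a ha g).2 hg))
        (fun g hg => Subgroup.mem_sup_right ((hL a ha g).2 hg))
    exact fun g hg => h hg
  intro a ha g
  refine ⟨fun h => ?_, key a ha g⟩
  have h' := key a⁻¹ (S.inv_mem ha) _ h
  rwa [← MulAut.mul_apply, ← map_mul, inv_mul_cancel, map_one, MulAut.one_apply] at h'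

end Invariance

section General

variable {G : Type*} [Group G] [TopologicalSpace G]

/-- `Γ` is a cocompact lattice of `G`: a discrete subgroup with compact quotient. -/
def IsCocompactLattice (Γ : Subgroup G) : Prop :=
  DiscreteTopology Γ ∧ CompactSpace (G ⧸ Γ)

/-- A rational subgroup (relative to `Γ`) is a connected closed subgroup `H` such that `H ∩ Γ` is
a cocompact lattice in `H`. -/
def IsRationalSubgroup (Γ H : Subgroup G) : Prop :=
  IsClosed (H : Set G) ∧ IsConnected (H : Set G) ∧ IsCocompactLattice (Γ.subgroupOf H)

/-- An action of `A` by automorphisms on the nilmanifold `G / Γ`, given by its lift to `G`: a group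
morphism from `A` to the continuous automorphisms of `G` that preserve `Γ`. (Each automorphism is
bicontinuous because the one of the inverse element is continuous too.) -/
structure NilAction (A : Type*) [Group A] (Γ : Subgroup G) where
  /-- The lifted action on `G`. -/
  lift : A →* MulAut G
  continuous_lift : ∀ a, Continuous (lift a)
  invariant_lattice : InvariantUnder lift ⊤ Γ

namespace NilAction

variable {A : Type*} [Group A] {Γ : Subgroup G}

/-- The self-map of `G / K` induced by `α a`, for an invariant subgroup `K`. -/
def quotientMap (α : NilAction A Γ) (K : Subgroup G) (hK : InvariantUnder α.lift ⊤ K) (a : A) :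
    G ⧸ K → G ⧸ K :=
  Quotient.map' (α.lift a) fun g h hgh => by
    rw [QuotientGroup.leftRel_apply] at hgh ⊢
    rw [← map_inv, ← map_mul]
    exact (hK a trivial _).2 hgh

@[simp] theorem quotientMap_mk (α : NilAction A Γ) (K : Subgroup G)
    (hK : InvariantUnder α.lift ⊤ K) (a : A) (g : G) :
    α.quotientMap K hK a (g : G ⧸ K) = ((α.lift a g : G) : G ⧸ K) := rfl

theorem continuous_quotientMap (α : NilAction A Γ) (K : Subgroup G)
    (hK : InvariantUnder α.lift ⊤ K) (a : A) : Continuous (α.quotientMap K hK a) :=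
  (continuous_quotient_mk'.comp (α.continuous_lift a)).quotient_lift _

theorem quotientMap_mul (α : NilAction A Γ) (K : Subgroup G)
    (hK : InvariantUnder α.lift ⊤ K) (a b : A) (p : G ⧸ K) :
    α.quotientMap K hK (a * b) p = α.quotientMap K hK a (α.quotientMap K hK b p) := by
  induction p using QuotientGroup.induction_on with
  | H g => simp

theorem quotientMap_one (α : NilAction A Γ) (K : Subgroup G)
    (hK : InvariantUnder α.lift ⊤ K) (p : G ⧸ K) : α.quotientMap K hK 1 p = p := by
  induction p using QuotientGroup.induction_on with
  | H g => simp

/-- The action of `A` by homeomorphisms on `G / K` induced by `α`, for an invariant subgroup `K`. -/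
def quotientAction (α : NilAction A Γ) (K : Subgroup G) (hK : InvariantUnder α.lift ⊤ K) :
    A →* ((G ⧸ K) ≃ₜ (G ⧸ K)) where
  toFun a :=
    { toFun := α.quotientMap K hK a
      invFun := α.quotientMap K hK a⁻¹
      left_inv := fun p => by rw [← quotientMap_mul, inv_mul_cancel, quotientMap_one]
      right_inv := fun p => by rw [← quotientMap_mul, mul_inv_cancel, quotientMap_one]
      continuous_toFun := α.continuous_quotientMap K hK a
      continuous_invFun := α.continuous_quotientMap K hK a⁻¹ }
  map_one' := Homeomorph.ext fun p => α.quotientMap_one K hK p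
  map_mul' a b := Homeomorph.ext fun p => α.quotientMap_mul K hK a b p

/-- The action of `A` on the nilmanifold `G / Γ` itself. -/
def onNil (α : NilAction A Γ) : A →* ((G ⧸ Γ) ≃ₜ (G ⧸ Γ)) :=
  α.quotientAction Γ α.invariant_lattice

/-- `X / H = G / HΓ` is an algebraic factor of the action `α` on `X = G / Γ`: `H` is an
`α`-invariant normal rational subgroup of `G`. -/
structure IsFactorSubgroup (α : NilAction A Γ) (H : Subgroup G) : Prop where
  normal : H.Normal
  rational : IsRationalSubgroup Γ H
  invariant : InvariantUnder α.lift ⊤ H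

/-- The algebraic factor action on `X / H = G / HΓ`. As `H` is normal, `H ⊔ Γ` is the
product set `HΓ`. -/
def factorAction (α : NilAction A Γ) {H : Subgroup G} (hH : α.IsFactorSubgroup H) :
    A →* ((G ⧸ (H ⊔ Γ)) ≃ₜ (G ⧸ (H ⊔ Γ))) :=
  α.quotientAction (H ⊔ Γ) (hH.invariant.sup α.invariant_lattice)

end NilAction

/-- The factor map `X = G / Γ → X / H = G / HΓ`. -/
def factorMap (Γ H : Subgroup G) : G ⧸ Γ → G ⧸ (H ⊔ Γ) :=
  Subgroup.quotientMapOfLE le_sup_right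

end General

/-! ## Properties of actions by homeomorphisms -/

open scoped IsMulCommutative in
/-- An action of an abelian group is virtually cyclic if its rank, that is the torsion-free rank of
its image in the group of homeomorphisms, is `0` or `1`. -/
def IsVirtuallyCyclic {A X : Type*} [CommGroup A] [TopologicalSpace X]
    (ρ : A →* (X ≃ₜ X)) : Prop :=
  Module.rank ℤ (Additive ρ.range) ≤ 1

/-- `α` has no virtually cyclic algebraic factor (the one-point factor, `H = G`, is
disregarded). -/
def NilAction.HasNoVirtuallyCyclicFactor {G : Type*} [Group G] [TopologicalSpace G]
    {A : Type*} [CommGroup A] {Γ : Subgroup G} (α : NilAction A Γ) : Prop :=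
  ∀ (H : Subgroup G) (hH : α.IsFactorSubgroup H), H ≠ ⊤ → ¬ IsVirtuallyCyclic (α.factorAction hH)

/-- Transport of an action along a homeomorphism. -/
def transportAction {A X Y : Type*} [Group A] [TopologicalSpace X] [TopologicalSpace Y]
    (e : X ≃ₜ Y) (ρ : A →* (X ≃ₜ X)) : A →* (Y ≃ₜ Y) where
  toFun a := (e.symm.trans (ρ a)).trans e
  map_one' := by ext; simp
  map_mul' a b := by ext; simp

/-- The standard torus `𝕋ᵈ = (ℝ/ℤ)ᵈ`. -/
abbrev Torus (d : ℕ) : Type := Fin d → UnitAddCircle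

/-- An action on `𝕋ᵈ` is totally irreducible if its restriction to any finite index subgroup leaves
invariant no subtorus (that is, no closed connected subgroup) other than `0` and `𝕋ᵈ`. -/
def IsTotallyIrreducible {A : Type*} [Group A] {d : ℕ}
    (ρ : A →* (Torus d ≃ₜ Torus d)) : Prop :=
  ∀ S : Subgroup A, S.FiniteIndex → ∀ T : AddSubgroup (Torus d),
    IsClosed (T : Set (Torus d)) → IsConnected (T : Set (Torus d)) →
    (∀ a ∈ S, ρ a '' (T : Set (Torus d)) = T) → T = ⊥ ∨ T = ⊤

/-- `μ` is ergodic under the restriction of the action `ρ` to the subgroup `S`: it is invariant, and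
every measurable set that is invariant up to null sets is null or conull. -/
def IsErgodicUnder {A X : Type*} [Group A] [TopologicalSpace X] [MeasurableSpace X]
    (ρ : A →* (X ≃ₜ X)) (S : Subgroup A) (μ : Measure X) : Prop :=
  (∀ a ∈ S, MeasurePreserving (ρ a) μ μ) ∧
    ∀ s : Set X, MeasurableSet s → (∀ a ∈ S, ρ a ⁻¹' s =ᵐ[μ] s) → μ s = 0 ∨ μ sᶜ = 0

/-- `m` is an `H`-invariant probability measure on a compact `H`-orbit. -/
structure IsInvariantOnCompactOrbit {G X : Type*} [Group G] [MulAction G X] [TopologicalSpace X]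
    [MeasurableSpace X] (H : Subgroup G) (m : Measure X) : Prop where
  prob : IsProbabilityMeasure m
  map_smul : ∀ h ∈ H, m.map (fun p => h • p) = m
  orbit : ∃ p : X, IsCompact (MulAction.orbit H p) ∧ m (MulAction.orbit H p)ᶜ = 0

/-- `μ` can be disintegrated into `H`-invariant probability measures on compact `H`-orbits:
`μ = ∫ κ y dν(y)` for a measurable family `κ` of such measures, defined for almost every point `y`
of a probability space. -/
def DisintegratesOverCompactOrbits {G X : Type*} [Group G] [MulAction G X] [TopologicalSpace X]
    [MeasurableSpace X] (H : Subgroup G) (μ : Measure X) : Prop :=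
  ∃ (Y : Type) (_ : MeasurableSpace Y) (ν : Measure Y) (κ : Kernel Y X),
    IsProbabilityMeasure ν ∧ ν.bind κ = μ ∧ ∀ᵐ y ∂ν, IsInvariantOnCompactOrbit H (κ y)

/-! ## A pair of commuting integer matrices -/

namespace HeisExample

open Polynomial Matrix

/-! The action is `(x, y, z) ↦ (U x, U⁻ᵀ y, z)`, where `U` runs through the powers of two commuting
integer matrices `A`, `B`. The characteristic polynomial of `A` is irreducible and palindromic. Its
roots are two real numbers `r ∈ (1, 2)` and `s < -2`, their inverses, and a conjugate pair `w`,
`w⁻¹` on the unit circle. The eigenvalue of `B` belonging to `λ` is `λ (λ - 2) / (1 - 2 λ)`, which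
has modulus one whenever `λ` does. So all of `ℤ²` acts by rotations on one real plane of `y`-space,
spanned by the real and imaginary parts of a left eigenvector `ξ`, while the action on the torus of
the `x` is irreducible of rank two.

Choose a small circle of points `w(θ) = Re (e(θ) ξ)` in that plane. The measure `μ` is the image of
Haar measure on `𝕋 × 𝕋⁶` under `(θ, x) ↦ (0, w(θ), 0) (x, 0, 0) Γ`. In these coordinates an element
of `ℤ²` acts as a rotation of `θ` times a toral automorphism of `x` (`onNil_param`), which gives the
invariance of `μ` and its Lebesgue projection. For a power of `A` the rotation is irrational, and
ergodicity follows by Fourier series: a character that involves `x` has an infinite orbit, and one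
in `θ` alone is multiplied by a scalar other than `1` (`measure_zero_or_compl_of_mFourier`).

The fibre of `μ` over `θ` is an orbit of the conjugate `{(x, 0, -2 x·w(θ))}`, and this subgroup
turns with `θ`. A connected `H` that preserves `μ` must preserve its support, which forces `H` into
`{(x, 0, 0) : x ⊥ w(θ) for all θ}` (`eq_of_preserves_nilMeasure`). If moreover `H` has a compact
orbit and is invariant under a finite index subgroup, its image in the torus is a closed invariant
subtorus, hence zero or everything. Zero gives `H` trivial, and everything contradicts the
orthogonality by a countability argument.

A nontrivial element of `ℤ²` has no eigenvalue `1`. If it acts trivially on `X / H`, then `H` covers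
the abelianization of `G` up to integer vectors. By Baire's theorem `H` covers all of it, and
commutators supply the centre, so `H = G`. Every other factor action is therefore faithful, of rank
two. -/

/-- The `6 × 6` integer matrices. -/
abbrev IntMat : Type := Matrix (Fin 6) (Fin 6) ℤ

/-- The first generator of the action: `1` plus a companion matrix. -/
def unitA : IntMatˣ where
  val := !![1, 1, 0, 0, 0, 0; 0, 1, 1, 0, 0, 0; 0, 0, 1, 1, 0, 0; 0, 0, 0, 1, 1, 0;
    0, 0, 0, 0, 1, 1; 6, 18, 10, -10, -16, -7]
  inv := !![7, 11, -1, -9, -7, -1; -6, -11, 1, 9, 7, 1; 6, 12, -1, -9, -7, -1;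
    -6, -12, 2, 9, 7, 1; 6, 12, -2, -8, -7, -1; -6, -12, 2, 8, 8, 1]
  val_inv := by decide +kernel
  inv_val := by decide +kernel

/-- The second generator of the action, `A (A - 2) (1 - 2 A)⁻¹`. -/
def unitB : IntMatˣ where
  val := !![289, 286, -93, -294, -180, -24; -144, -143, 46, 147, 90, 12;
    72, 72, -23, -74, -45, -6; -36, -36, 12, 37, 22, 3; 18, 18, -6, -18, -11, -2;
    -12, -18, -2, 14, 14, 5]
  inv := !![7, 32, 53, 42, 17, 2; 12, 43, 52, 33, 10, 1; 6, 30, 53, 42, 17, 2;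
    12, 42, 50, 33, 10, 1; 6, 30, 52, 40, 17, 2; 12, 42, 50, 32, 8, 1]
  val_inv := by decide +kernel
  inv_val := by decide +kernel

theorem unitA_mul_unitB : unitA * unitB = unitB * unitA :=
  Units.ext (by decide +kernel)

/-- This is `B (1 - 2 A) = A (A - 2)`, freed of inverses and differences. It determines the action
of `B` on every eigenvector of `A`. -/
theorem unitB_relation : (unitB : IntMat) + 2 • (unitA : IntMat) =
    (unitA : IntMat) * unitA + 2 • ((unitB : IntMat) * unitA) := by decide +kernel

/-- The action of `ℤ²` by powers of the two generators. -/
def unitHom : Multiplicative (ℤ × ℤ) →* IntMatˣ where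
  toFun a := unitA ^ a.toAdd.1 * unitB ^ a.toAdd.2
  map_one' := by simp
  map_mul' a b := by
    have h : Commute unitA unitB := unitA_mul_unitB
    simp only [toAdd_mul, Prod.fst_add, Prod.snd_add, _root_.zpow_add]
    rw [mul_assoc, mul_assoc, ← mul_assoc (unitA ^ b.toAdd.1) (unitB ^ a.toAdd.2),
      (h.zpow_zpow b.toAdd.1 a.toAdd.2).eq, mul_assoc]

theorem unitHom_apply (a : Multiplicative (ℤ × ℤ)) :
    unitHom a = unitA ^ a.toAdd.1 * unitB ^ a.toAdd.2 := rfl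

/-! ### The characteristic polynomial and its irreducibility -/

/-- The characteristic polynomial of `A - 1`. -/
noncomputable def shiftPoly : ℤ[X] :=
  X ^ 6 + (C 8 * X ^ 5 + C 16 * X ^ 4 + C 10 * X ^ 3 + C (-10) * X ^ 2 + C (-18) * X + C (-6))

theorem degree_shiftPoly_tail :
    (C 8 * X ^ 5 + C 16 * X ^ 4 + C 10 * X ^ 3 + C (-10) * X ^ 2 + C (-18) * X + C (-6) : ℤ[X]).degree < 6 := by
  have : (C 8 * X ^ 5 + C 16 * X ^ 4 + C 10 * X ^ 3 + C (-10) * X ^ 2 + C (-18) * X + C (-6) : ℤ[X]).degree ≤ 5 := by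
    compute_degree
  exact lt_of_le_of_lt this (by norm_num)

theorem monic_shiftPoly : shiftPoly.Monic := monic_X_pow_add degree_shiftPoly_tail

theorem natDegree_shiftPoly : shiftPoly.natDegree = 6 := by
  unfold shiftPoly; compute_degree!

/-- Eisenstein at `2`. The characteristic polynomial of `A` itself has constant term `1`; the shift
by `1` makes all lower coefficients even, with constant term `-6`. -/
theorem irreducible_shiftPoly : Irreducible shiftPoly := by
  have hE : shiftPoly.IsEisensteinAt (Ideal.span {2}) := by
    refine ⟨?_, fun {n} hn => ?_, ?_⟩
    · rw [monic_shiftPoly.leadingCoeff, Ideal.mem_span_singleton]; decide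
    · rw [natDegree_shiftPoly] at hn
      rw [Ideal.mem_span_singleton]
      interval_cases n <;>
        simp only [shiftPoly, coeff_X, coeff_X_pow, coeff_C_mul, coeff_C, coeff_add] <;> decide
    · rw [Ideal.span_singleton_pow, Ideal.mem_span_singleton]
      simp only [shiftPoly, coeff_X, coeff_X_pow, coeff_C_mul, coeff_C, coeff_add]
      decide
  exact hE.irreducible ((Ideal.span_singleton_prime two_ne_zero).2 Int.prime_two)
    monic_shiftPoly.isPrimitive (by rw [natDegree_shiftPoly]; norm_num)

theorem minpoly_of_root {η : ℂ} (h : aeval η shiftPoly = 0) :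
    minpoly ℚ η = shiftPoly.map (Int.castRingHom ℚ) := by
  refine (minpoly.eq_of_irreducible_of_monic ?_ ?_ (monic_shiftPoly.map _)).symm
  · exact (IsPrimitive.Int.irreducible_iff_irreducible_map_cast
      monic_shiftPoly.isPrimitive).1 irreducible_shiftPoly
  · have := aeval_map_algebraMap (A := ℚ) η shiftPoly
    rw [h] at this
    exact this

/-- A polynomial relation over `ℤ` between the powers of one root holds for every root. -/
theorem aeval_eq_zero_of_root {η η' : ℂ} (h : aeval η shiftPoly = 0)
    (h' : aeval η' shiftPoly = 0) {f : ℤ[X]} (hf : aeval η f = 0) : aeval η' f = 0 := by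
  have h1 : aeval η (f.map (algebraMap ℤ ℚ)) = 0 := by rw [aeval_map_algebraMap, hf]
  have h2 : minpoly ℚ η' ∣ f.map (algebraMap ℤ ℚ) := by
    rw [minpoly_of_root h', ← minpoly_of_root h]
    exact minpoly.dvd _ _ h1
  rw [← aeval_map_algebraMap (A := ℚ)]
  exact aeval_eq_zero_of_dvd_aeval_eq_zero h2 (minpoly.aeval _ _)

/-- The pairing of an integer vector with the vector of the powers of `η`. -/
noncomputable def pair (k : Fin 6 → ℤ) (η : ℂ) : ℂ := ∑ i, (k i : ℂ) * η ^ (i : ℕ)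

/-- The minimal polynomial of `η` has degree six, so `1, η, …, η⁵` are independent over `ℚ`. Through
this pairing an integer vector is controlled by any single eigenvalue. -/
theorem eq_zero_of_pair_eq_zero {η : ℂ} (h : aeval η shiftPoly = 0) {k : Fin 6 → ℤ}
    (hk : pair k η = 0) : k = 0 := by
  set f : ℚ[X] := ∑ i : Fin 6, C (k i : ℚ) * X ^ (i : ℕ) with hf
  have h1 : aeval η f = 0 := by
    simpa [hf, pair] using hk
  have h2 : f.degree < (minpoly ℚ η).degree := by
    rw [minpoly_of_root h, monic_shiftPoly.degree_map, degree_eq_natDegree monic_shiftPoly.ne_zero,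
      natDegree_shiftPoly]
    refine (degree_sum_le _ _).trans_lt ((Finset.sup_lt_iff (WithBot.bot_lt_coe 6)).2 fun i _ => ?_)
    refine (degree_C_mul_X_pow_le _ _).trans_lt ?_
    exact_mod_cast i.2
  have h3 : f = 0 := by
    by_contra hne
    exact absurd (minpoly.degree_le_of_ne_zero ℚ η hne h1) (not_le.2 h2)
  funext i
  have h4 : f.coeff i = k i := by
    simp [hf, finsetSum_coeff, coeff_X_pow, Fin.val_inj]
  rw [h3, coeff_zero] at h4
  exact_mod_cast h4.symm

/-! ### Eigenvalues and eigenvectors -/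

/-- An integer matrix with complex entries. -/
abbrev toC (M : IntMat) : Matrix (Fin 6) (Fin 6) ℂ := (Int.castRingHom ℂ).mapMatrix M

/-- The eigenvalue of `B` belonging to the eigenvalue `l` of `A`. -/
noncomputable def secondEigenvalue (l : ℂ) : ℂ := l * (l - 2) / (1 - 2 * l)

/-- The vector of the powers of `η`. -/
noncomputable def powVec (η : ℂ) : Fin 6 → ℂ := fun i => η ^ (i : ℕ)

theorem pair_eq_dotProduct (k : Fin 6 → ℤ) (η : ℂ) :
    pair k η = (fun i => (k i : ℂ)) ⬝ᵥ powVec η := rfl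

theorem unitA_mulVec {η : ℂ} (h : aeval η shiftPoly = 0) :
    toC unitA *ᵥ powVec η = (1 + η) • powVec η := by
  have h' : η ^ 6 + (8 * η ^ 5 + 16 * η ^ 4 + 10 * η ^ 3 - 10 * η ^ 2 - 18 * η - 6) = 0 := by
    simp only [shiftPoly, map_add, map_mul, map_pow, aeval_X, aeval_C] at h
    push_cast [eq_intCast] at h
    linear_combination h
  funext i
  fin_cases i <;>
    simp [unitA, powVec, Matrix.mulVec, dotProduct, Fin.sum_univ_succ]
  · ring
  · ring
  · ring
  · ring
  · linear_combination -h'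

theorem toC_relation : toC unitB + (2 : ℂ) • toC unitA =
    toC unitA * toC unitA + (2 : ℂ) • (toC unitB * toC unitA) := by
  have := congrArg (Int.castRingHom ℂ).mapMatrix unitB_relation
  rw [map_add, map_add, map_nsmul, map_nsmul, map_mul, map_mul] at this
  simpa only [two_smul] using this

theorem unitB_mulVec {l : ℂ} (hl : 1 - 2 * l ≠ 0) {v : Fin 6 → ℂ}
    (h : toC unitA *ᵥ v = l • v) : toC unitB *ᵥ v = secondEigenvalue l • v := by
  have := congrArg (· *ᵥ v) toC_relation
  simp only [add_mulVec, smul_mulVec, ← mulVec_mulVec, h, mulVec_smul, smul_smul] at this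
  have h2 : (1 - 2 * l) • (toC unitB *ᵥ v) = (l * (l - 2)) • v := by
    funext i
    have := congrFun this i
    simp only [Pi.add_apply, Pi.smul_apply, smul_eq_mul] at this ⊢
    linear_combination this
  rw [secondEigenvalue, div_eq_inv_mul, mul_smul, ← h2, smul_smul, inv_mul_cancel₀ hl, one_smul]

theorem vecMul_unitB {l : ℂ} (hl : 1 - 2 * l ≠ 0) {v : Fin 6 → ℂ}
    (h : v ᵥ* toC unitA = l • v) : v ᵥ* toC unitB = secondEigenvalue l • v := by
  -- The relation contains `B A`, but a left eigenvector has to meet `A` first.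
  have hc : toC unitB * toC unitA = toC unitA * toC unitB := by
    have := congrArg (Int.castRingHom ℂ).mapMatrix (congrArg Units.val unitA_mul_unitB)
    rw [Units.val_mul, Units.val_mul, map_mul, map_mul] at this
    exact this.symm
  have := congrArg (v ᵥ* ·) toC_relation
  simp only [hc, vecMul_add, vecMul_smul, ← vecMul_vecMul, h, smul_vecMul, smul_smul] at this
  have h2 : (1 - 2 * l) • (v ᵥ* toC unitB) = (l * (l - 2)) • v := by
    funext i
    have := congrFun this i
    simp only [Pi.add_apply, Pi.smul_apply, smul_eq_mul] at this ⊢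
    linear_combination this
  rw [secondEigenvalue, div_eq_inv_mul, mul_smul, ← h2, smul_smul, inv_mul_cancel₀ hl, one_smul]

/-- Carries an eigenvector equation through integer powers of matrix and eigenvalue together. The
relation `P` will include `c ≠ 0`, which the inversion step needs. -/
theorem zpow_induction_pair {G : Type*} [Group G] {P : G → ℂ → Prop} (one : P 1 1)
    (mul : ∀ g h c d, P g c → P h d → P (g * h) (c * d))
    (inv : ∀ g c, P g c → P g⁻¹ c⁻¹) {g : G} {c : ℂ} (h : P g c) (n : ℤ) :
    P (g ^ n) (c ^ n) := by
  have hn : ∀ m : ℕ, P (g ^ m) (c ^ m) := fun m => by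
    induction m with
    | zero => simpa using one
    | succ m ih => rw [pow_succ, pow_succ]; exact mul _ _ _ _ ih h
  cases n with
  | ofNat m => simpa using hn m
  | negSucc m =>
    rw [zpow_negSucc, zpow_negSucc]
    exact inv _ _ (hn _)

theorem eigen_inv {U : IntMatˣ} {c : ℂ} (hc : c ≠ 0) {v : Fin 6 → ℂ}
    (h : toC U *ᵥ v = c • v) : toC (U⁻¹ : IntMatˣ) *ᵥ v = c⁻¹ • v := by
  have h1 : toC (U⁻¹ : IntMatˣ) * toC U = 1 := by
    rw [toC, toC, ← map_mul, Units.inv_mul, map_one]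
  have h2 := congrArg (toC (U⁻¹ : IntMatˣ) *ᵥ ·) h
  simp only [mulVec_mulVec, h1, one_mulVec, mulVec_smul] at h2
  rw [eq_inv_smul_iff₀ hc, ← h2]

theorem eigen_inv' {U : IntMatˣ} {c : ℂ} (hc : c ≠ 0) {v : Fin 6 → ℂ}
    (h : v ᵥ* toC U = c • v) : v ᵥ* toC (U⁻¹ : IntMatˣ) = c⁻¹ • v := by
  have h1 : toC U * toC (U⁻¹ : IntMatˣ) = 1 := by
    rw [toC, toC, ← map_mul, Units.mul_inv, map_one]
  have h2 := congrArg (· ᵥ* toC (U⁻¹ : IntMatˣ)) h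
  simp only [vecMul_vecMul, h1, vecMul_one, smul_vecMul] at h2
  rw [eq_inv_smul_iff₀ hc, ← h2]

/-- The eigenvalue of `A ^ i * B ^ j`. -/
noncomputable def eigenvalue (l : ℂ) (a : Multiplicative (ℤ × ℤ)) : ℂ :=
  l ^ a.toAdd.1 * secondEigenvalue l ^ a.toAdd.2

theorem unitHom_mulVec {l : ℂ} (h0 : l ≠ 0) (hs : secondEigenvalue l ≠ 0) (hl : 1 - 2 * l ≠ 0)
    {v : Fin 6 → ℂ} (h : toC unitA *ᵥ v = l • v) (a : Multiplicative (ℤ × ℤ)) :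
    toC (unitHom a : IntMat) *ᵥ v = eigenvalue l a • v := by
  have key : ∀ (U : IntMatˣ) (c : ℂ), c ≠ 0 → toC U *ᵥ v = c • v → ∀ n : ℤ,
      toC (U ^ n : IntMatˣ) *ᵥ v = c ^ n • v := fun U c hc hU n =>
    (zpow_induction_pair (P := fun U c => c ≠ 0 ∧ toC (U : IntMatˣ) *ᵥ v = c • v)
      ⟨one_ne_zero, by simp [toC]⟩
      (fun U V c d hU hV => ⟨mul_ne_zero hU.1 hV.1, by
        rw [toC, Units.val_mul, map_mul, ← mulVec_mulVec, hV.2, mulVec_smul, hU.2, smul_smul,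
          mul_comm]⟩)
      (fun U c hU => ⟨inv_ne_zero hU.1, eigen_inv hU.1 hU.2⟩) ⟨hc, hU⟩ n).2
  rw [unitHom_apply, toC, Units.val_mul, map_mul, ← mulVec_mulVec,
    key _ _ hs (unitB_mulVec hl h), mulVec_smul, key _ _ h0 h, smul_smul, eigenvalue, mul_comm]

theorem vecMul_unitHom {l : ℂ} (h0 : l ≠ 0) (hs : secondEigenvalue l ≠ 0) (hl : 1 - 2 * l ≠ 0)
    {v : Fin 6 → ℂ} (h : v ᵥ* toC unitA = l • v) (a : Multiplicative (ℤ × ℤ)) :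
    v ᵥ* toC (unitHom a : IntMat) = eigenvalue l a • v := by
  have key : ∀ (U : IntMatˣ) (c : ℂ), c ≠ 0 → v ᵥ* toC U = c • v → ∀ n : ℤ,
      v ᵥ* toC (U ^ n : IntMatˣ) = c ^ n • v := fun U c hc hU n =>
    (zpow_induction_pair (P := fun U c => c ≠ 0 ∧ v ᵥ* toC (U : IntMatˣ) = c • v)
      ⟨one_ne_zero, by simp [toC]⟩
      (fun U V c d hU hV => ⟨mul_ne_zero hU.1 hV.1, by
        rw [toC, Units.val_mul, map_mul, ← vecMul_vecMul, hU.2, smul_vecMul, hV.2, smul_smul]⟩)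
      (fun U c hU => ⟨inv_ne_zero hU.1, eigen_inv' hU.1 hU.2⟩) ⟨hc, hU⟩ n).2
  rw [unitHom_apply, toC, Units.val_mul, map_mul, ← vecMul_vecMul, key _ _ h0 h, smul_vecMul,
    key _ _ hs (vecMul_unitB hl h), smul_smul, eigenvalue]

theorem pair_vecMul {M : IntMat} {c η : ℂ} (h : toC M *ᵥ powVec η = c • powVec η)
    (k : Fin 6 → ℤ) : pair (k ᵥ* M) η = c * pair k η := by
  have h1 : (fun i => ((k ᵥ* M) i : ℂ)) = (fun i => (k i : ℂ)) ᵥ* toC M := by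
    funext i
    simp [vecMul, dotProduct]
  rw [pair_eq_dotProduct, pair_eq_dotProduct, h1, ← dotProduct_mulVec, h, dotProduct_smul,
    smul_eq_mul]

end HeisExample

namespace HeisExample

open Polynomial Matrix

/-! ### The roots -/

/-- `l` is an eigenvalue of `A`. -/
def IsRootA (l : ℂ) : Prop :=
  l ^ 6 + 2 * l ^ 5 - 9 * l ^ 4 + 6 * l ^ 3 - 9 * l ^ 2 + 2 * l + 1 = 0

theorem isRootA_iff (l : ℂ) : IsRootA l ↔ aeval (l - 1) shiftPoly = 0 := by
  simp only [IsRootA, shiftPoly, map_add, map_mul, map_pow, aeval_X, aeval_C]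
  push_cast [eq_intCast]
  ring_nf

theorem IsRootA.ne_zero {l : ℂ} (h : IsRootA l) : l ≠ 0 := by
  rintro rfl
  simp [IsRootA] at h

/-- The polynomial is palindromic. -/
theorem IsRootA.inv {l : ℂ} (h : IsRootA l) : IsRootA l⁻¹ := by
  have h0 := h.ne_zero
  unfold IsRootA at h ⊢
  field_simp
  linear_combination h

theorem IsRootA.two_mul_ne {l : ℂ} (h : IsRootA l) : 1 - 2 * l ≠ 0 := by
  intro h1
  have : l = 1 / 2 := by linear_combination (-1 / 2 : ℂ) * h1
  rw [this, IsRootA] at h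
  norm_num at h

theorem IsRootA.ne_two {l : ℂ} (h : IsRootA l) : l - 2 ≠ 0 := by
  intro h1
  have : l = 2 := by linear_combination h1
  rw [this, IsRootA] at h
  norm_num at h

theorem IsRootA.secondEigenvalue_ne_zero {l : ℂ} (h : IsRootA l) : secondEigenvalue l ≠ 0 :=
  div_ne_zero (mul_ne_zero h.ne_zero h.ne_two) h.two_mul_ne

theorem IsRootA.mulVec {l : ℂ} (h : IsRootA l) :
    toC unitA *ᵥ powVec (l - 1) = l • powVec (l - 1) := by
  have := unitA_mulVec ((isRootA_iff l).1 h)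
  rwa [add_sub_cancel] at this

theorem IsRootA.unitHom_mulVec {l : ℂ} (h : IsRootA l) (a : Multiplicative (ℤ × ℤ)) :
    toC (unitHom a : IntMat) *ᵥ powVec (l - 1) = eigenvalue l a • powVec (l - 1) :=
  HeisExample.unitHom_mulVec h.ne_zero h.secondEigenvalue_ne_zero h.two_mul_ne h.mulVec a

theorem IsRootA.pair_ne_zero {l : ℂ} (h : IsRootA l) {k : Fin 6 → ℤ} (hk : k ≠ 0) :
    pair k (l - 1) ≠ 0 :=
  fun h0 => hk (eq_zero_of_pair_eq_zero ((isRootA_iff l).1 h) h0)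

theorem IsRootA.pair_vecMul {l : ℂ} (h : IsRootA l) (a : Multiplicative (ℤ × ℤ))
    (k : Fin 6 → ℤ) :
    pair (k ᵥ* (unitHom a : IntMat)) (l - 1) = eigenvalue l a * pair k (l - 1) :=
  HeisExample.pair_vecMul (h.unitHom_mulVec a) k

theorem exists_root_gt_one : ∃ l : ℝ, 1 < l ∧ l < 2 ∧ IsRootA l := by
  have hc : ContinuousOn (fun l : ℝ => l ^ 6 + 2 * l ^ 5 - 9 * l ^ 4 + 6 * l ^ 3 - 9 * l ^ 2 +
    2 * l + 1) (Set.Icc 1 2) := by fun_prop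
  obtain ⟨l, ⟨h1, h2⟩, h⟩ := intermediate_value_Ioo (by norm_num) hc
    (show (0 : ℝ) ∈ Set.Ioo _ _ by constructor <;> norm_num)
  exact ⟨l, h1, h2, by unfold IsRootA; exact_mod_cast h⟩

theorem exists_root_lt_neg_two : ∃ l : ℝ, l < -2 ∧ IsRootA l := by
  have hc : ContinuousOn (fun l : ℝ => l ^ 6 + 2 * l ^ 5 - 9 * l ^ 4 + 6 * l ^ 3 - 9 * l ^ 2 +
    2 * l + 1) (Set.Icc (-5) (-2)) := by fun_prop
  obtain ⟨l, ⟨h1, h2⟩, h⟩ := intermediate_value_Ioo' (by norm_num) hc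
    (show (0 : ℝ) ∈ Set.Ioo _ _ by constructor <;> norm_num)
  exact ⟨l, h2, by unfold IsRootA; exact_mod_cast h⟩

/-- Dividing the palindromic sextic by `l³` and putting `t = l + l⁻¹` gives the cubic `t³ + 2t² -
12t + 2`. A root `t` in `(0, 1)` is twice the real part of a root `l` on the unit circle. -/
theorem exists_root_norm_one : ∃ l : ℂ, ‖l‖ = 1 ∧ IsRootA l := by
  have hc : ContinuousOn (fun t : ℝ => t ^ 3 + 2 * t ^ 2 - 12 * t + 2) (Set.Icc 0 1) := by fun_prop
  obtain ⟨t, ⟨h1, h2⟩, h⟩ := intermediate_value_Ioo' (by norm_num) hc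
    (show (0 : ℝ) ∈ Set.Ioo _ _ by constructor <;> norm_num)
  set s := √(1 - (t / 2) ^ 2)
  have hs : s ^ 2 = 1 - (t / 2) ^ 2 := Real.sq_sqrt (by nlinarith)
  have hsC : (s : ℂ) ^ 2 = 1 - ((t : ℂ) / 2) ^ 2 := by exact_mod_cast hs
  have hC : (t : ℂ) ^ 3 + 2 * (t : ℂ) ^ 2 - 12 * t + 2 = 0 := by exact_mod_cast h
  refine ⟨⟨t / 2, s⟩, ?_, ?_⟩
  · rw [← sq_eq_sq₀ (norm_nonneg _) zero_le_one, Complex.sq_norm, Complex.normSq_mk]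
    nlinarith
  · have hl : (⟨t / 2, s⟩ : ℂ) = t / 2 + s * Complex.I := by
      apply Complex.ext <;> simp
    set l : ℂ := ⟨t / 2, s⟩
    have hq : l ^ 2 + 1 = t * l := by
      rw [hl]
      linear_combination hsC * (Complex.I ^ 2 : ℂ) + (1 - (t : ℂ) ^ 2 / 4) * Complex.I_sq
    unfold IsRootA
    linear_combination l ^ 3 * hC + ((l ^ 2 + 1) ^ 2 + (l ^ 2 + 1) * (t * l) + (t * l) ^ 2 +
      2 * l * ((l ^ 2 + 1) + t * l) - 12 * l ^ 2) * hq

/-- The relation `l ^ m = 1` would pass to the conjugate root `r > 1`. -/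
theorem pow_ne_one_of_root {l : ℂ} (h : IsRootA l) {m : ℕ} (hm : m ≠ 0) : l ^ m ≠ 1 := by
  obtain ⟨r, hr1, -, hr⟩ := exists_root_gt_one
  intro h1
  have := aeval_eq_zero_of_root ((isRootA_iff l).1 h) ((isRootA_iff r).1 hr)
    (f := (X + 1) ^ m - 1) (by simp [h1])
  have h2 : (r : ℂ) ^ m = 1 := by simpa [sub_eq_zero] using this
  have h3 : r ^ m = 1 := by exact_mod_cast h2
  exact (one_lt_pow₀ hr1 hm).ne' h3

theorem zpow_ne_one_of_root {l : ℂ} (h : IsRootA l) {m : ℤ} (hm : m ≠ 0) : l ^ m ≠ 1 := by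
  intro h1
  refine pow_ne_one_of_root h (Int.natAbs_ne_zero.2 hm) ?_
  rcases Int.natAbs_eq m with h2 | h2
  · rw [h2, zpow_natCast] at h1
    exact h1
  · rw [h2, _root_.zpow_neg, zpow_natCast, inv_eq_one] at h1
    exact h1

/-- The reason for the choice of `B`: on the unit circle `1 - 2 l` equals `l` times the conjugate of
`l - 2`, so numerator and denominator have the same modulus. -/
theorem norm_secondEigenvalue_of_norm_one {l : ℂ} (hl : ‖l‖ = 1) (h : IsRootA l) :
    ‖secondEigenvalue l‖ = 1 := by
  have h1 : 1 - 2 * l = l * (starRingEnd ℂ (l - 2)) := by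
    have : l * starRingEnd ℂ l = 1 := by
      rw [Complex.mul_conj, Complex.normSq_eq_norm_sq, hl]; simp
    rw [map_sub, mul_sub, this]
    rw [map_ofNat]
    ring
  have h2 : ‖1 - 2 * l‖ = ‖l - 2‖ := by
    rw [h1, norm_mul, hl, one_mul, RCLike.norm_conj]
  rw [secondEigenvalue, norm_div, norm_mul, hl, h2, one_mul,
    div_self (norm_ne_zero_iff.2 h.ne_two)]

theorem norm_eigenvalue_of_norm_one {l : ℂ} (hl : ‖l‖ = 1) (h : IsRootA l)
    (a : Multiplicative (ℤ × ℤ)) : ‖eigenvalue l a‖ = 1 := by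
  rw [eigenvalue, norm_mul, norm_zpow, norm_zpow, hl, norm_secondEigenvalue_of_norm_one hl h]
  simp

/-- Eigenvalues of nontrivial elements at all embeddings are never simultaneously `1`. -/
theorem exists_eigenvalue_ne_one {a : Multiplicative (ℤ × ℤ)} (ha : a ≠ 1) :
    ∃ l, IsRootA l ∧ eigenvalue l a ≠ 1 := by
  obtain ⟨r, hr1, hr2, hr⟩ := exists_root_gt_one
  obtain ⟨s, hs1, hs⟩ := exists_root_lt_neg_two
  by_contra! hcon
  have h1 := hcon r hr
  have h2 := hcon s hs
  set m := a.toAdd.1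
  set n := a.toAdd.2
  have e1 : r ^ m * (r * (r - 2) / (1 - 2 * r)) ^ n = 1 := by
    have : ((r ^ m * (r * (r - 2) / (1 - 2 * r)) ^ n : ℝ) : ℂ) = 1 := by
      push_cast; exact h1
    exact_mod_cast this
  have e2 : s ^ m * (s * (s - 2) / (1 - 2 * s)) ^ n = 1 := by
    have : ((s ^ m * (s * (s - 2) / (1 - 2 * s)) ^ n : ℝ) : ℂ) = 1 := by
      push_cast; exact h2
    exact_mod_cast this
  set u := r * (r - 2) / (1 - 2 * r)
  set v := s * (s - 2) / (1 - 2 * s)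
  have hu0 : 0 < u := div_pos_of_neg_of_neg (by nlinarith) (by linarith)
  have hu1 : u < 1 := by
    rw [div_lt_one_of_neg (by linarith)]; nlinarith
  have hv1 : 1 < v := by
    rw [one_lt_div (by linarith)]; nlinarith
  have l1 := congrArg Real.log e1
  rw [Real.log_mul (zpow_ne_zero _ (by linarith)) (zpow_ne_zero _ hu0.ne'), Real.log_zpow,
    Real.log_zpow, Real.log_one] at l1
  have l2 := congrArg Real.log e2
  rw [Real.log_mul (zpow_ne_zero _ (by linarith)) (zpow_ne_zero _ (by linarith)), Real.log_zpow,
    Real.log_zpow, Real.log_one] at l2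
  have p1 : 0 < Real.log r := Real.log_pos hr1
  have p2 : Real.log u < 0 := Real.log_neg hu0 hu1
  have p3 : 0 < Real.log s := by
    rw [← Real.log_abs]; exact Real.log_pos (by rw [lt_abs]; right; linarith)
  have p4 : 0 < Real.log v := Real.log_pos hv1
  -- The logarithms at the two real places form a linear system in `m`, `n`. Its determinant is
  -- positive because `log u` is the only negative entry (`Real.log s` means `log |s|`).
  have hdet : (m : ℝ) * (Real.log r * Real.log v - Real.log u * Real.log s) = 0 := by
    linear_combination Real.log v * l1 - Real.log u * l2
  have hpos : 0 < Real.log r * Real.log v - Real.log u * Real.log s := by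
    have := mul_pos p1 p4
    have := mul_pos (neg_pos.2 p2) p3
    linarith
  have hm : (m : ℝ) = 0 := (mul_eq_zero.1 hdet).resolve_right hpos.ne'
  have hn : (n : ℝ) = 0 := by
    rw [hm, zero_mul, zero_add] at l2
    exact (mul_eq_zero.1 l2).resolve_right p4.ne'
  apply ha
  apply Multiplicative.toAdd.injective
  exact Prod.ext (by exact_mod_cast hm) (by exact_mod_cast hn)

/-- The matrices of nontrivial elements do not have the eigenvalue `1`. -/
theorem det_unitHom_sub_one_ne_zero {a : Multiplicative (ℤ × ℤ)} (ha : a ≠ 1) :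
    ((unitHom a : IntMat) - 1).det ≠ 0 := by
  intro hdet
  obtain ⟨k, hk, h⟩ := Matrix.exists_vecMul_eq_zero_iff.2 hdet
  obtain ⟨l, hl, hl1⟩ := exists_eigenvalue_ne_one ha
  rw [vecMul_sub, vecMul_one, sub_eq_zero] at h
  have := hl.pair_vecMul a k
  rw [h] at this
  exact hl1 (mul_right_cancel₀ (hl.pair_ne_zero hk) (by rw [one_mul]; exact this.symm))

theorem eigenvalue_ofAdd_fst (m : ℤ) (l : ℂ) :
    eigenvalue l (Multiplicative.ofAdd (m, 0)) = l ^ m := by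
  simp [eigenvalue]

/-! ### The dual action on integer vectors -/

/-- Six eigenvalues whose powers stay distinct. -/
theorem exists_six_roots (m : ℕ) (hm : m ≠ 0) :
    ∃ l : Fin 6 → ℂ, (∀ i, IsRootA (l i)) ∧ Function.Injective fun i => l i ^ m := by
  obtain ⟨r, hr1, hr2, hr⟩ := exists_root_gt_one
  obtain ⟨s, hs1, hs⟩ := exists_root_lt_neg_two
  obtain ⟨w, hw1, hw⟩ := exists_root_norm_one
  -- The six moduli are `1/|s| < 1/r < 1 = 1 < r < |s|`, so only `w` and `w⁻¹` are not separated by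
  -- their modulus.
  have hc : w ^ m ≠ w⁻¹ ^ m := by
    intro h
    refine pow_ne_one_of_root hw (m := m + m) (by omega) ?_
    rw [pow_add]
    nth_rewrite 2 [h]
    rw [← mul_pow, mul_inv_cancel₀ hw.ne_zero, one_pow]
  have n1 : ‖(r : ℂ)‖ = r := by
    rw [Complex.norm_real, Real.norm_of_nonneg (by linarith)]
  have n2 : ‖(s : ℂ)‖ = -s := by
    rw [Complex.norm_real, Real.norm_of_nonpos (by linarith)]
  have lt : ∀ x y : ℂ, ‖x‖ < ‖y‖ → ‖x ^ m‖ < ‖y ^ m‖ := fun x y h => by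
    rw [norm_pow, norm_pow]; exact pow_lt_pow_left₀ h (norm_nonneg _) hm
  have c1 := lt (s : ℂ)⁻¹ (r : ℂ)⁻¹ (by
    rw [norm_inv, norm_inv, n1, n2]; exact inv_strictAnti₀ (by linarith) (by linarith))
  have c2 := lt (r : ℂ)⁻¹ w (by
    rw [norm_inv, n1, hw1]; exact inv_lt_one_of_one_lt₀ hr1)
  have c3 := lt w r (by rw [n1, hw1]; exact hr1)
  have c4 := lt r s (by rw [n1, n2]; linarith)
  have c5 : ‖w⁻¹ ^ m‖ = ‖w ^ m‖ := by rw [norm_pow, norm_pow, norm_inv, hw1, inv_one]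
  refine ⟨![(s : ℂ)⁻¹, (r : ℂ)⁻¹, w, w⁻¹, r, s], ?_, ?_⟩
  · intro i
    fin_cases i
    exacts [hs.inv, hr.inv, hw, hw.inv, hr, hs]
  · intro i j hij
    fin_cases i <;> fin_cases j <;> first
      | rfl
      | exact absurd hij hc
      | exact absurd hij.symm hc
      | (exfalso
         have := congrArg norm hij
         simp only [Fin.zero_eta, Fin.isValue, Matrix.cons_val, Fin.mk_one, Fin.reduceFinMk] at this
         linarith)

/-- A nonzero subgroup of `ℤ⁶` that is invariant under a power of `Aᵀ` has finite index. -/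
theorem exists_single_mem_of_invariant {m : ℕ} (hm : m ≠ 0) {W : AddSubgroup (Fin 6 → ℤ)}
    (hW : ∀ k ∈ W, k ᵥ* (unitHom (Multiplicative.ofAdd ((m : ℤ), 0)) : IntMat) ∈ W)
    (hne : W ≠ ⊥) : ∃ N : ℤ, N ≠ 0 ∧ ∀ i, Pi.single i N ∈ W := by
  obtain ⟨k, hkW, hk⟩ := W.bot_or_exists_ne_zero.resolve_left hne
  set M : IntMat := (unitHom (Multiplicative.ofAdd ((m : ℤ), 0)) : IntMat)
  -- The rows `k, kM, …, kM⁵` lie in `W`. A linear relation among them would be a polynomial of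
  -- degree at most five vanishing at the six distinct numbers `l i ^ m`.
  set Q : IntMat := Matrix.of fun j => k ᵥ* M ^ (j : ℕ)
  have hrow : ∀ n : ℕ, k ᵥ* M ^ n ∈ W := fun n => by
    induction n with
    | zero => simpa using hkW
    | succ n ih =>
      rw [pow_succ, ← vecMul_vecMul]
      exact hW _ ih
  obtain ⟨l, hl, hinj⟩ := exists_six_roots m hm
  have hpair : ∀ (i : Fin 6) (n : ℕ),
      pair (k ᵥ* M ^ n) (l i - 1) = (l i ^ m) ^ n * pair k (l i - 1) := fun i n => by
    induction n with
    | zero => simp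
    | succ n ih =>
      rw [pow_succ, ← vecMul_vecMul, (hl i).pair_vecMul, eigenvalue_ofAdd_fst, ih, zpow_natCast]
      ring
  have hdet : Q.det ≠ 0 := by
    intro h
    obtain ⟨c, hc, h⟩ := Matrix.exists_vecMul_eq_zero_iff.2 h
    set f : ℂ[X] := ∑ j : Fin 6, C (c j : ℂ) * X ^ (j : ℕ) with hf
    have hroot : ∀ i, f.eval (l i ^ m) = 0 := fun i => by
      have h1 : pair (c ᵥ* Q) (l i - 1) = f.eval (l i ^ m) * pair k (l i - 1) := by
        have : pair (c ᵥ* Q) (l i - 1) = ∑ j, (c j : ℂ) * pair (k ᵥ* M ^ (j : ℕ)) (l i - 1) := by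
          simp only [pair, vecMul, dotProduct, Q, Matrix.of_apply, Finset.mul_sum, Int.cast_sum,
            Int.cast_mul, Finset.sum_mul]
          rw [Finset.sum_comm]
          refine Finset.sum_congr rfl fun a _ => Finset.sum_congr rfl fun b _ => ?_
          ring_nf
        rw [this, hf, eval_finsetSum, Finset.sum_mul]
        refine Finset.sum_congr rfl fun j _ => ?_
        rw [hpair]
        simp only [eval_mul, eval_C, eval_pow, eval_X]
        ring
      rw [h] at h1
      have h2 : pair (0 : Fin 6 → ℤ) (l i - 1) = 0 := by simp [pair]
      rw [h2] at h1
      exact (mul_eq_zero.1 h1.symm).resolve_right ((hl i).pair_ne_zero hk)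
    have hdeg : f.degree < 6 := by
      refine (degree_sum_le _ _).trans_lt ((Finset.sup_lt_iff (WithBot.bot_lt_coe 6)).2 fun i _ => ?_)
      refine (degree_C_mul_X_pow_le _ _).trans_lt ?_
      exact_mod_cast i.2
    have hf0 : f = 0 := by
      refine eq_zero_of_degree_lt_of_eval_index_eq_zero (Finset.univ : Finset (Fin 6))
        (v := fun i => l i ^ m) hinj.injOn ?_ fun i _ => hroot i
      simpa using hdeg
    apply hc
    funext i
    have h4 : f.coeff i = c i := by
      simp [hf, finsetSum_coeff, coeff_X_pow, Fin.val_inj]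
    rw [hf0, coeff_zero] at h4
    exact_mod_cast h4.symm
  refine ⟨Q.det, hdet, fun i => ?_⟩
  -- Cramer's rule: the adjugate writes `det Q` times a basis vector as an integer combination of
  -- the rows of `Q`.
  have h1 : (Pi.single i Q.det : Fin 6 → ℤ) = Q.adjugate i ᵥ* Q := by
    have h2 : (Q.adjugate * Q) i = Q.adjugate i ᵥ* Q := by
      funext j; simp [Matrix.mul_apply, vecMul, dotProduct]
    rw [← h2, Matrix.adjugate_mul]
    funext j
    by_cases hij : j = i
    · subst hij; simp
    · simp [Pi.single_eq_of_ne hij, Matrix.one_apply_ne' hij]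
  rw [h1, vecMul_eq_sum]
  exact W.sum_mem fun j _ => W.zsmul_mem (hrow j) _

/-- The transposed action on nonzero integer vectors has infinite orbits. -/
theorem iterate_vecMul_injective {m : ℕ} (hm : m ≠ 0) {k : Fin 6 → ℤ} (hk : k ≠ 0) :
    Function.Injective fun n : ℕ =>
      (fun k => k ᵥ* (unitHom (Multiplicative.ofAdd ((m : ℤ), 0)) : IntMat))^[n] k := by
  obtain ⟨r, hr1, -, hr⟩ := exists_root_gt_one
  -- Each step multiplies the pairing at the real root `r > 1` by `r ^ m`, so it never repeats a
  -- value.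
  have hpair : ∀ n : ℕ,
      pair ((fun k => k ᵥ* (unitHom (Multiplicative.ofAdd ((m : ℤ), 0)) : IntMat))^[n] k) (r - 1) =
        (r ^ m) ^ n * pair k (r - 1) := fun n => by
    induction n with
    | zero => simp
    | succ n ih =>
      rw [Function.iterate_succ_apply', hr.pair_vecMul, ih, eigenvalue_ofAdd_fst, zpow_natCast]
      ring
  intro n n' h
  have h1 := congrArg (pair · (r - 1)) h
  simp only [hpair] at h1
  have h2 := mul_right_cancel₀ (hr.pair_ne_zero hk) h1
  have h3 : (r ^ m) ^ n = (r ^ m) ^ n' := by exact_mod_cast h2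
  exact pow_right_injective₀ (by positivity) (one_lt_pow₀ hr1 hm).ne' h3

/-- A common eigenvector of the transposed matrices on which the action is isometric. -/
theorem exists_isometric_eigenvector : ∃ (ξ : Fin 6 → ℂ) (χ : Multiplicative (ℤ × ℤ) → ℂ),
    ξ ≠ 0 ∧ (∀ a, ‖χ a‖ = 1) ∧ (∀ a, ξ ᵥ* toC (unitHom a : IntMat) = χ a • ξ) ∧
    ∀ m : ℤ, m ≠ 0 → ∀ n : ℤ, n ≠ 0 → χ (Multiplicative.ofAdd (m, 0)) ^ n ≠ 1 := by
  obtain ⟨l, hl1, hl⟩ := exists_root_norm_one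
  -- The right eigenvector `powVec` is explicit; the vanishing determinant converts it into a left
  -- one.
  have hdet : (toC unitA - l • (1 : Matrix (Fin 6) (Fin 6) ℂ)).det = 0 := by
    refine Matrix.exists_mulVec_eq_zero_iff.1 ⟨powVec (l - 1), fun h => ?_, ?_⟩
    · have := congrFun h 0
      simp [powVec] at this
    · rw [sub_mulVec, hl.mulVec, smul_mulVec, one_mulVec, sub_self]
  obtain ⟨ξ, hξ, h⟩ := Matrix.exists_vecMul_eq_zero_iff.2 hdet
  rw [vecMul_sub, vecMul_smul, vecMul_one, sub_eq_zero] at h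
  refine ⟨ξ, eigenvalue l, hξ, norm_eigenvalue_of_norm_one hl1 hl,
    vecMul_unitHom hl.ne_zero hl.secondEigenvalue_ne_zero hl.two_mul_ne h, fun m hm n hn => ?_⟩
  rw [eigenvalue_ofAdd_fst, ← _root_.zpow_mul]
  exact zpow_ne_one_of_root hl (mul_ne_zero hm hn)

end HeisExample

namespace HeisExample

open UnitAddTorus Matrix

/-! ### Fourier analysis on tori -/

section Fourier

variable {d : Type*} [Fintype d]

theorem volume_unitAddCircle : (volume : Measure UnitAddCircle) = AddCircle.haarAddCircle := by
  rw [AddCircle.volume_eq_smul_haarAddCircle]; simp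

instance : IsProbabilityMeasure (volume : Measure UnitAddCircle) :=
  ⟨UnitAddCircle.measure_univ⟩

/-- **Parseval's identity** for indicator functions on the torus. -/
theorem hasSum_sq_setIntegral_mFourier {s : Set (UnitAddTorus d)} (hs : MeasurableSet s) :
    HasSum (fun k : d → ℤ => ‖∫ t in s, mFourier k t‖ ^ 2) (volume.real s) := by
  have hvol : (volume : Measure (UnitAddTorus d)) =
      Measure.pi fun _ => (AddCircle.haarAddCircle : Measure UnitAddCircle) := by
    rw [volume_pi, volume_unitAddCircle]
  rw [hvol]
  set μ := Measure.pi fun _ : d => (AddCircle.haarAddCircle : Measure UnitAddCircle)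
  have hμ : μ s ≠ ⊤ := measure_ne_top μ s
  have h := hasSum_sq_mFourierCoeff (indicatorConstLp 2 hs hμ (1 : ℂ))
  have h1 : ∀ k : d → ℤ, ‖mFourierCoeff (indicatorConstLp 2 hs hμ (1 : ℂ)) k‖ =
      ‖∫ t in s, mFourier k t ∂μ‖ := fun k => by
    -- Fourier coefficients integrate against the character `-k`; the conjugation disappears in the
    -- norm.
    have e1 : mFourierCoeff (indicatorConstLp 2 hs hμ (1 : ℂ)) k =
        ∫ t, s.indicator (fun t => mFourier (-k) t) t ∂μ := by
      refine integral_congr_ae ?_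
      filter_upwards [indicatorConstLp_coeFn (μ := μ) (p := 2) (hs := hs) (hμs := hμ) (c := (1 : ℂ))]
        with t ht
      rw [ht]
      by_cases hts : t ∈ s <;> simp [hts]
    rw [e1, integral_indicator hs]
    simp_rw [mFourier_neg]
    rw [integral_conj, RCLike.norm_conj]
  have h2 : ∫ t, ‖indicatorConstLp 2 hs hμ (1 : ℂ) t‖ ^ 2 ∂μ = μ.real s := by
    have : ∫ t, ‖indicatorConstLp 2 hs hμ (1 : ℂ) t‖ ^ 2 ∂μ = ∫ t, s.indicator 1 t ∂μ := by
      refine integral_congr_ae ?_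
      filter_upwards [indicatorConstLp_coeFn (μ := μ) (p := 2) (hs := hs) (hμs := hμ) (c := (1 : ℂ))]
        with t ht
      rw [ht]
      by_cases hts : t ∈ s <;> simp [hts]
    rw [this, integral_indicator_one hs]
  simp only [h1] at h
  rw [← h2]
  exact h

theorem mFourier_eq_toCircle (k : d → ℤ) (t : UnitAddTorus d) :
    mFourier k t = ((∑ i, k i • t i).toCircle : ℂ) := by
  have h : ∀ s : Finset d, ((∑ i ∈ s, k i • t i).toCircle : ℂ) =
      ∏ i ∈ s, ((k i • t i).toCircle : ℂ) := fun s => by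
    classical
    induction s using Finset.induction_on with
    | empty => simp
    | insert a s ha ih =>
      rw [Finset.sum_insert ha, Finset.prod_insert ha, AddCircle.toCircle_add, Circle.coe_mul, ih]
  rw [h]
  rfl

theorem mFourier_eq_one_iff (k : d → ℤ) (t : UnitAddTorus d) :
    mFourier k t = 1 ↔ ∑ i, k i • t i = 0 := by
  rw [mFourier_eq_toCircle]
  constructor
  · intro h
    apply AddCircle.injective_toCircle one_ne_zero
    rw [AddCircle.toCircle_zero]
    exact Circle.ext (by simpa using h)
  · intro h
    rw [h]; simp

theorem mFourier_add_apply (k : d → ℤ) (t u : UnitAddTorus d) :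
    mFourier k (t + u) = mFourier k t * mFourier k u := by
  simp only [mFourier_eq_toCircle, ← Circle.coe_mul, ← AddCircle.toCircle_add,
    ← Finset.sum_add_distrib, Pi.add_apply, smul_add]

/-- A Fourier-analytic criterion for ergodicity of a map that permutes the characters of a torus up
to scalars. -/
theorem measure_zero_or_compl_of_mFourier {T : UnitAddTorus d → UnitAddTorus d}
    (hT : MeasurePreserving T volume volume) {L : (d → ℤ) → d → ℤ} {c : (d → ℤ) → ℂ}
    (hc : ∀ k, ‖c k‖ = 1) (h : ∀ k t, mFourier k (T t) = c k * mFourier (L k) t)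
    (horb : ∀ k ≠ 0, (Function.Injective fun n : ℕ => L^[n] k) ∨ (L k = k ∧ c k ≠ 1))
    {s : Set (UnitAddTorus d)} (hs : MeasurableSet s) (hinv : T ⁻¹' s =ᵐ[volume] s) :
    volume s = 0 ∨ volume sᶜ = 0 := by
  set F : (d → ℤ) → ℂ := fun k => ∫ t in s, mFourier k t with hF
  have hsum := hasSum_sq_setIntegral_mFourier hs
  have hFL : ∀ k, F k = c k * F (L k) := fun k => by
    have h1 : F k = ∫ t in T ⁻¹' s, mFourier k (T t) := by
      have := setIntegral_map (μ := volume) (g := T) hs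
        (f := fun t => mFourier k t) (by fun_prop) hT.measurable.aemeasurable
      rw [hT.map_eq] at this
      exact this
    rw [h1, setIntegral_congr_set hinv]
    simp_rw [h]
    rw [integral_const_mul]
  have hnorm : ∀ k, ‖F (L k)‖ = ‖F k‖ := fun k => by
    rw [hFL k, norm_mul, hc, one_mul]
  have hzero : ∀ k ≠ 0, F k = 0 := by
    intro k hk
    rcases horb k hk with hinj | ⟨hk1, hk2⟩
    -- Invariance makes `‖F‖` constant along the orbit of `k`, and a constant is summable over an
    -- infinite orbit only if it is zero.
    · have hs1 : Summable fun n : ℕ => ‖F (L^[n] k)‖ ^ 2 := hsum.summable.comp_injective hinj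
      have hconst : ∀ n : ℕ, ‖F (L^[n] k)‖ = ‖F k‖ := fun n => by
        induction n with
        | zero => rfl
        | succ n ih => rw [Function.iterate_succ_apply', hnorm, ih]
      simp_rw [hconst] at hs1
      have := (summable_const_iff _).1 hs1
      simpa using this
    · have h1 := hFL k
      rw [hk1] at h1
      have h2 : (c k - 1) * F k = 0 := by linear_combination -h1
      exact (mul_eq_zero.1 h2).resolve_left (sub_ne_zero.2 hk2)
  have h0 : F 0 = volume.real s := by
    simp [hF, mFourier_zero]
  have h2 : HasSum (fun k => ‖F k‖ ^ 2) (‖F 0‖ ^ 2) :=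
    hasSum_single 0 fun k hk => by simp [hzero k hk]
  -- Only the constant character survives in Parseval's identity.
  have h3 : volume.real s = volume.real s ^ 2 := by
    have := hsum.unique h2
    rw [h0] at this
    simpa using this
  have h4 : volume.real s * (1 - volume.real s) = 0 := by linear_combination h3
  rcases mul_eq_zero.1 h4 with h5 | h5
  · left
    exact (measureReal_eq_zero_iff).1 h5
  · right
    rw [← measureReal_eq_zero_iff, probReal_compl_eq_one_sub hs, h5]

/-- Integration of continuous functions against a probability measure. -/
noncomputable def integralCLM {X : Type*} [TopologicalSpace X] [CompactSpace X]
    [MeasurableSpace X] [BorelSpace X] (μ : Measure X) [IsProbabilityMeasure μ] :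
    C(X, ℂ) →L[ℂ] ℂ :=
  LinearMap.mkContinuous
    { toFun := fun f => ∫ x, f x ∂μ
      map_add' := fun f g => integral_add
        (f.continuous.integrable_of_hasCompactSupport (HasCompactSupport.of_compactSpace f))
        (g.continuous.integrable_of_hasCompactSupport (HasCompactSupport.of_compactSpace g))
      map_smul' := fun c f => integral_const_mul c _ } 1 fun f => by
    have := norm_integral_le_of_norm_le_const (μ := μ) (f := f) (C := ‖f‖)
      (Filter.Eventually.of_forall f.norm_coe_le_norm)
    simpa using this

theorem integral_mFourier_eq_zero {μ : Measure (UnitAddTorus d)}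
    {t₀ : UnitAddTorus d} (hμ : MeasurePreserving (fun t => t₀ + t) μ μ) {k : d → ℤ}
    (hk : mFourier k t₀ ≠ 1) : ∫ t, mFourier k t ∂μ = 0 := by
  have h1 : ∫ t, mFourier k (t₀ + t) ∂μ = ∫ t, mFourier k t ∂μ :=
    hμ.integral_comp (Homeomorph.addLeft t₀).measurableEmbedding _
  simp_rw [mFourier_add_apply] at h1
  rw [integral_const_mul] at h1
  have h2 : (mFourier k t₀ - 1) * ∫ t, mFourier k t ∂μ = 0 := by linear_combination h1
  exact (mul_eq_zero.1 h2).resolve_left (sub_ne_zero.2 hk)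

/-- A closed subgroup of the torus that is annihilated by no nontrivial character is the whole
torus. -/
theorem eq_top_of_annihilator_trivial {T : AddSubgroup (UnitAddTorus d)}
    (hT : IsClosed (T : Set (UnitAddTorus d)))
    (h : ∀ k : d → ℤ, (∀ t ∈ T, ∑ i, k i • t i = 0) → k = 0) : T = ⊤ := by
  have : CompactSpace T := isCompact_iff_compactSpace.1 hT.isCompact
  -- Haar measure of `T`, seen on the torus, has the Fourier coefficients of Lebesgue measure, since
  -- every nontrivial character is nontrivial on `T`.
  set ν : Measure T := Measure.addHaarMeasure ⊤
  have : IsProbabilityMeasure ν := ⟨Measure.addHaarMeasure_self (K₀ := ⊤)⟩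
  have hval : Measurable (Subtype.val : T → UnitAddTorus d) := measurable_subtype_coe
  set μ : Measure (UnitAddTorus d) := ν.map Subtype.val
  have : IsProbabilityMeasure μ := Measure.isProbabilityMeasure_map hval.aemeasurable
  have hμT : ∀ t₀ ∈ T, MeasurePreserving (fun t => t₀ + t) μ μ := fun t₀ ht₀ => by
    have hadd : Measurable fun t : UnitAddTorus d => t₀ + t :=
      (continuous_const.add continuous_id).measurable
    refine ⟨hadd, ?_⟩
    rw [Measure.map_map hadd hval]
    have h1 : (fun t => t₀ + t) ∘ (Subtype.val : T → UnitAddTorus d) =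
        Subtype.val ∘ fun t : T => (⟨t₀, ht₀⟩ : T) + t := rfl
    rw [h1, ← Measure.map_map hval (measurable_const_add _), map_add_left_eq_self]
  have hEq : integralCLM μ = integralCLM (volume : Measure (UnitAddTorus d)) := by
    refine ContinuousLinearMap.ext_on (s := Set.range (mFourier (d := d))) ?_ ?_
    · exact Submodule.dense_iff_topologicalClosure_eq_top.2 span_mFourier_closure_eq_top
    · rintro _ ⟨k, rfl⟩
      change ∫ t, mFourier k t ∂μ = ∫ t, mFourier k t
      by_cases hk : k = 0
      · subst hk; simp [mFourier_zero]
      · obtain ⟨t₀, ht₀, hne⟩ : ∃ t₀ ∈ T, mFourier k t₀ ≠ 1 := by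
          by_contra! hcon
          exact hk (h k fun t ht => (mFourier_eq_one_iff k t).1 (hcon t ht))
        rw [integral_mFourier_eq_zero (hμT t₀ ht₀) hne,
          integral_mFourier_eq_zero (measurePreserving_add_left volume t₀) hne]
  -- The distance to `T` integrates to zero over `T`, hence over the whole torus; being continuous
  -- and nonnegative it vanishes everywhere.
  set f : C(UnitAddTorus d, ℂ) :=
    ⟨fun t => (Metric.infDist t (T : Set (UnitAddTorus d)) : ℂ), by fun_prop⟩
  have h1 : ∫ t, f t ∂μ = ∫ t, f t := DFunLike.congr_fun hEq f
  have h2 : ∫ t, f t ∂μ = 0 := by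
    rw [integral_map hval.aemeasurable f.continuous.aestronglyMeasurable]
    refine integral_eq_zero_of_ae (Filter.Eventually.of_forall fun t => ?_)
    simp [f, Metric.infDist_zero_of_mem t.2]
  rw [h2] at h1
  have h3 : ∫ t : UnitAddTorus d, Metric.infDist t (T : Set (UnitAddTorus d)) = 0 := by
    have : ∫ t, f t = ((∫ t : UnitAddTorus d, Metric.infDist t (T : Set (UnitAddTorus d)) : ℝ) : ℂ) :=
      integral_ofReal
    rw [this] at h1
    exact_mod_cast h1.symm
  have hcont : Continuous fun t => Metric.infDist t (T : Set (UnitAddTorus d)) :=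
    Metric.continuous_infDist_pt _
  rw [integral_eq_zero_iff_of_nonneg (fun t => Metric.infDist_nonneg)
    (hcont.integrable_of_hasCompactSupport (HasCompactSupport.of_compactSpace _))] at h3
  have h4 := (hcont.ae_eq_iff_eq volume continuous_zero).1 h3
  refine (AddSubgroup.eq_top_iff' T).2 fun t => ?_
  exact (hT.mem_iff_infDist_zero ⟨0, T.zero_mem⟩).2 (congrFun h4 t)

end Fourier

/-! ### Toral endomorphisms -/

/-- The endomorphism of the torus given by an integer matrix. -/
noncomputable def torusMap (M : IntMat) : Torus 6 →+ Torus 6 where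
  toFun t i := ∑ j, M i j • t j
  map_zero' := by ext; simp
  map_add' s t := by ext i; simp [Finset.sum_add_distrib]

theorem torusMap_apply (M : IntMat) (t : Torus 6) (i : Fin 6) :
    torusMap M t i = ∑ j, M i j • t j := rfl

theorem continuous_torusMap (M : IntMat) : Continuous (torusMap M) :=
  continuous_pi fun i => show Continuous fun t : Torus 6 => ∑ j, M i j • t j from
    continuous_finsetSum _ fun j _ => (continuous_apply j).zsmul _

theorem torusMap_mul (M N : IntMat) (t : Torus 6) :
    torusMap (M * N) t = torusMap M (torusMap N t) := by
  ext i
  simp only [torusMap_apply, Matrix.mul_apply, Finset.sum_smul, Finset.smul_sum, smul_smul]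
  rw [Finset.sum_comm]

theorem torusMap_one (t : Torus 6) : torusMap 1 t = t := by
  ext i
  simp [torusMap_apply, Matrix.one_apply, ite_smul]

theorem surjective_torusMap (U : IntMatˣ) : Function.Surjective (torusMap U) := fun t =>
  ⟨torusMap (U⁻¹ : IntMatˣ) t, by rw [← torusMap_mul, Units.mul_inv, torusMap_one]⟩

theorem sum_zsmul_torusMap (M : IntMat) (k : Fin 6 → ℤ) (t : Torus 6) :
    ∑ i, k i • torusMap M t i = ∑ i, (k ᵥ* M) i • t i := by
  simp only [torusMap_apply, vecMul, dotProduct, Finset.sum_smul, Finset.smul_sum, smul_smul]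
  rw [Finset.sum_comm]

/-- The projection of `ℝ⁶` to the torus. -/
def toTorus (x : Fin 6 → ℝ) : Torus 6 := fun i => (x i : UnitAddCircle)

theorem continuous_toTorus : Continuous toTorus :=
  continuous_pi fun i => (AddCircle.continuous_mk' (1 : ℝ)).comp (continuous_apply i)

theorem toTorus_add (x y : Fin 6 → ℝ) : toTorus (x + y) = toTorus x + toTorus y := rfl

theorem toTorus_eq_iff {x y : Fin 6 → ℝ} :
    toTorus x = toTorus y ↔ ∃ k : Fin 6 → ℤ, y = x + fun i => (k i : ℝ) := by
  constructor
  · intro h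
    have : ∀ i, ∃ n : ℤ, y i = x i + n := fun i => by
      have h1 : ((y i - x i : ℝ) : UnitAddCircle) = 0 := by
        rw [AddCircle.coe_sub, sub_eq_zero]; exact (congrFun h i).symm
      obtain ⟨n, hn⟩ := (AddCircle.coe_eq_zero_iff (1 : ℝ)).1 h1
      exact ⟨n, by simp at hn; linarith⟩
    choose k hk using this
    exact ⟨k, funext hk⟩
  · rintro ⟨k, rfl⟩
    funext i
    simp [toTorus]

theorem surjective_toTorus : Function.Surjective toTorus := fun t =>
  ⟨fun i => (QuotientAddGroup.mk_surjective (t i)).choose,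
    funext fun i => (QuotientAddGroup.mk_surjective (t i)).choose_spec⟩

/-- An integer matrix with real entries. -/
abbrev toR (M : IntMat) : Matrix (Fin 6) (Fin 6) ℝ := (Int.castRingHom ℝ).mapMatrix M

theorem torusMap_toTorus (M : IntMat) (x : Fin 6 → ℝ) :
    torusMap M (toTorus x) = toTorus (toR M *ᵥ x) := by
  funext i
  have h : ∀ s : Finset (Fin 6), ((∑ j ∈ s, (M i j : ℝ) * x j : ℝ) : UnitAddCircle) =
      ∑ j ∈ s, M i j • (x j : UnitAddCircle) := fun s => by
    induction s using Finset.induction_on with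
    | empty => simp
    | insert a s ha ih =>
      rw [Finset.sum_insert ha, Finset.sum_insert ha, AddCircle.coe_add, ih, ← zsmul_eq_mul,
        AddCircle.coe_zsmul]
  exact (h Finset.univ).symm

/-- Closed connected subgroups of the torus that are invariant under a power of `A` are trivial. -/
theorem eq_bot_or_top_of_torusMap_mem {m : ℕ} (hm : m ≠ 0) {T : AddSubgroup (Torus 6)}
    (hc : IsClosed (T : Set (Torus 6))) (hconn : IsConnected (T : Set (Torus 6)))
    (hT : ∀ t ∈ T, torusMap (unitHom (Multiplicative.ofAdd ((m : ℤ), 0)) : IntMat) t ∈ T) :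
    T = ⊥ ∨ T = ⊤ := by
  -- The annihilator of `T`, invariant under the transposed matrix. If it is nonzero, it contains
  -- multiples of all basis vectors, so `T` consists of torsion points of bounded order and
  -- connectedness makes it trivial.
  set W : AddSubgroup (Fin 6 → ℤ) :=
    { carrier := {k | ∀ t ∈ T, ∑ i, k i • t i = 0}
      zero_mem' := fun t _ => by simp
      add_mem' := fun {k l} hk hl t ht => by
        simp [add_smul, Finset.sum_add_distrib, hk t ht, hl t ht]
      neg_mem' := fun {k} hk t ht => by
        simp [neg_smul, hk t ht] } with hWdef
  by_cases hW : W = ⊥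
  · right
    refine eq_top_of_annihilator_trivial hc fun k hk => ?_
    have : k ∈ W := hk
    rwa [hW, AddSubgroup.mem_bot] at this
  · left
    obtain ⟨N, hN, hmem⟩ := exists_single_mem_of_invariant hm (W := W)
      (fun k hk t ht => by rw [← sum_zsmul_torusMap]; exact hk _ (hT t ht)) hW
    have htor : ∀ t ∈ T, ∀ i, N • t i = 0 := fun t ht i => by
      have := hmem i t ht
      rw [Finset.sum_eq_single i (fun j _ hj => by simp [Pi.single_eq_of_ne hj]) (by simp)] at this
      simpa using this
    refine (AddSubgroup.eq_bot_iff_forall T).2 fun t ht => funext fun i => ?_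
    have hfin : {u : UnitAddCircle | N.natAbs • u = 0}.Finite :=
      AddCircle.finite_torsion 1 (Int.natAbs_pos.2 hN)
    have htd : IsTotallyDisconnected {u : UnitAddCircle | N.natAbs • u = 0} :=
      hfin.countable.isTotallyDisconnected
    have hsub := htd ((fun t : Torus 6 => t i) '' T) (by
      rintro _ ⟨t, ht, rfl⟩
      have := htor t ht i
      rcases Int.natAbs_eq N with h | h
      · rw [h, natCast_zsmul] at this
        exact this
      · rw [h, neg_smul, natCast_zsmul, neg_eq_zero] at this
        exact this) (hconn.isPreconnected.image _ (continuous_apply i).continuousOn)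
    exact hsub ⟨t, ht, rfl⟩ ⟨0, T.zero_mem, rfl⟩

/-! ### The product of a rotation and a toral automorphism -/

/-- The seven-dimensional torus. -/
abbrev BigTorus : Type := UnitAddTorus (Option (Fin 6))

/-- The projection of the seven-dimensional torus that forgets the first coordinate. -/
def bigProj : BigTorus →+ Torus 6 where
  toFun t j := t (some j)
  map_zero' := rfl
  map_add' _ _ := rfl

/-- The linear part of `bigMap`. -/
noncomputable def bigHom (M : IntMat) : BigTorus →+ BigTorus where
  toFun t o := o.elim (t none) (torusMap M (bigProj t))
  map_zero' := by ext o; cases o <;> simp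
  map_add' s t := by ext o; cases o <;> simp

/-- The product of the rotation by `β` and the toral endomorphism given by `M`. -/
noncomputable def bigMap (M : IntMat) (β : UnitAddCircle) (t : BigTorus) : BigTorus :=
  Pi.single none β + bigHom M t

theorem bigMap_none (M : IntMat) (β : UnitAddCircle) (t : BigTorus) :
    bigMap M β t none = t none + β := by
  simp [bigMap, bigHom, add_comm]

theorem bigProj_bigMap (M : IntMat) (β : UnitAddCircle) (t : BigTorus) :
    bigProj (bigMap M β t) = torusMap M (bigProj t) := by
  funext i
  simp [bigMap, bigHom, bigProj]

theorem continuous_bigProj : Continuous bigProj :=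
  continuous_pi fun i => continuous_apply (some i)

theorem continuous_bigHom (M : IntMat) : Continuous (bigHom M) :=
  continuous_pi fun o => by
    cases o with
    | none => exact continuous_apply none
    | some i =>
      exact (continuous_apply i).comp ((continuous_torusMap M).comp continuous_bigProj)

theorem surjective_bigHom (U : IntMatˣ) : Function.Surjective (bigHom U) := fun t => by
  obtain ⟨u, hu⟩ := surjective_torusMap U (bigProj t)
  refine ⟨fun o => o.elim (t none) u, ?_⟩
  funext o
  cases o with
  | none => rfl
  | some i => exact congrFun hu i

theorem measurePreserving_bigProj : MeasurePreserving bigProj volume volume :=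
  bigProj.measurePreserving continuous_bigProj
    (fun t => ⟨fun o => o.elim 0 t, rfl⟩) (by simp)

theorem measurePreserving_bigMap (U : IntMatˣ) (β : UnitAddCircle) :
    MeasurePreserving (bigMap U β) volume volume :=
  (measurePreserving_add_left volume _).comp
    ((bigHom U).measurePreserving (continuous_bigHom U) (surjective_bigHom U) rfl)

/-- The action on characters dual to `bigMap`. -/
def bigDual (M : IntMat) (k : Option (Fin 6) → ℤ) : Option (Fin 6) → ℤ :=
  fun o => o.elim (k none) ((fun i => k (some i)) ᵥ* M)

theorem mFourier_bigMap (M : IntMat) (β : UnitAddCircle) (k : Option (Fin 6) → ℤ) (t : BigTorus) :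
    mFourier k (bigMap M β t) = (((k none) • β).toCircle : ℂ) * mFourier (bigDual M k) t := by
  rw [mFourier_eq_toCircle, mFourier_eq_toCircle, ← Circle.coe_mul, ← AddCircle.toCircle_add]
  congr 2
  rw [Fintype.sum_option, Fintype.sum_option, bigMap_none]
  have h1 : ∀ i, bigMap M β t (some i) = torusMap M (bigProj t) i := fun i =>
    congrFun (bigProj_bigMap M β t) i
  simp_rw [h1]
  rw [sum_zsmul_torusMap M (fun i => k (some i)), smul_add]
  simp only [bigDual, Option.elim, bigProj, AddMonoidHom.coe_mk, ZeroHom.coe_mk]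
  abel

theorem bigDual_iterate (M : IntMat) (k : Option (Fin 6) → ℤ) (n : ℕ) (i : Fin 6) :
    (bigDual M)^[n] k (some i) = (fun k => k ᵥ* M)^[n] (fun i => k (some i)) i := by
  have : ∀ n : ℕ, (fun i => (bigDual M)^[n] k (some i)) =
      (fun k => k ᵥ* M)^[n] (fun i => k (some i)) := fun n => by
    induction n with
    | zero => rfl
    | succ n ih => rw [Function.iterate_succ_apply', Function.iterate_succ_apply', ← ih]; rfl
  exact congrFun (this n) i

/-- The product of an irrational rotation and a power of `A` is ergodic. -/
theorem measure_zero_or_compl_of_bigMap {m : ℕ} (hm : m ≠ 0) {β : UnitAddCircle}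
    (hβ : ∀ n : ℤ, n ≠ 0 → n • β ≠ 0) {s : Set BigTorus} (hs : MeasurableSet s)
    (hinv : bigMap (unitHom (Multiplicative.ofAdd ((m : ℤ), 0))) β ⁻¹' s =ᵐ[volume] s) :
    volume s = 0 ∨ volume sᶜ = 0 := by
  refine measure_zero_or_compl_of_mFourier (measurePreserving_bigMap _ β)
    (c := fun k => ((k none • β).toCircle : ℂ)) (fun k => Circle.norm_coe _)
    (mFourier_bigMap _ β) (fun k hk => ?_) hs hinv
  -- Characters of the circle alone are fixed and scaled by the rotation; all others have infinite
  -- orbits.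
  by_cases h : (fun i => k (some i)) = 0
  · right
    have hk0 : k none ≠ 0 := fun h0 => hk <| funext fun o => by
      cases o with
      | none => exact h0
      | some i => exact congrFun h i
    refine ⟨funext fun o => ?_, fun h1 => hβ _ hk0 ?_⟩
    · cases o with
      | none => rfl
      | some i =>
        simp only [bigDual, Option.elim, h, zero_vecMul]
        exact (congrFun h i).symm
    · apply AddCircle.injective_toCircle one_ne_zero
      rw [AddCircle.toCircle_zero]
      exact Circle.ext (by simpa using h1)
  · left
    intro n n' hn
    refine iterate_vecMul_injective hm h (funext fun i => ?_)
    have := congrFun hn (some i)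
    simp only [bigDual_iterate] at this
    exact this

end HeisExample

/-! ### The Heisenberg group as a Lie group -/

namespace Heis

open Matrix

variable {n : ℕ}

@[simp] theorem mk_x (x y : Fin n → ℝ) (z : ℝ) : (mk x y z).x = x := rfl
@[simp] theorem mk_y (x y : Fin n → ℝ) (z : ℝ) : (mk x y z).y = y := rfl
@[simp] theorem mk_z (x y : Fin n → ℝ) (z : ℝ) : (mk x y z).z = z := rfl

theorem continuous_x : Continuous (x : Heis n → Fin n → ℝ) :=
  (continuous_fst : Continuous (Prod.fst : HeisSpace n → _))

theorem continuous_y : Continuous (y : Heis n → Fin n → ℝ) :=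
  (continuous_fst.comp continuous_snd : Continuous fun g : HeisSpace n => g.2.1)

theorem continuous_z : Continuous (z : Heis n → ℝ) :=
  (continuous_snd.comp continuous_snd : Continuous fun g : HeisSpace n => g.2.2)

theorem continuous_mk {X : Type*} [TopologicalSpace X] {f g : X → Fin n → ℝ} {h : X → ℝ}
    (hf : Continuous f) (hg : Continuous g) (hh : Continuous h) :
    Continuous fun p => mk (f p) (g p) (h p) :=
  (hf.prodMk (hg.prodMk hh) : Continuous fun p => ((f p, g p, h p) : HeisSpace n))

instance : T2Space (Heis n) := inferInstanceAs (T2Space (HeisSpace n))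
instance : SigmaCompactSpace (Heis n) := inferInstanceAs (SigmaCompactSpace (HeisSpace n))

instance : IsManifold 𝓘(ℝ, HeisSpace n) ∞ (Heis n) :=
  inferInstanceAs (IsManifold 𝓘(ℝ, HeisSpace n) ∞ (HeisSpace n))

theorem contDiff_mul : ContDiff ℝ ∞ fun p : HeisSpace n × HeisSpace n =>
    ((p.1.1 + p.2.1, p.1.2.1 + p.2.2.1,
      p.1.2.2 + p.2.2.2 + p.1.1 ⬝ᵥ p.2.2.1 - p.2.1 ⬝ᵥ p.1.2.1) : HeisSpace n) := by
  unfold dotProduct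
  fun_prop

theorem contDiff_inv : ContDiff ℝ ∞ fun p : HeisSpace n =>
    ((-p.1, -p.2.1, -p.2.2) : HeisSpace n) := by
  fun_prop

instance lieGroup : LieGroup 𝓘(ℝ, HeisSpace n) ∞ (Heis n) where
  contMDiff_mul := by
    have h1 : ContMDiff (𝓘(ℝ, HeisSpace n).prod 𝓘(ℝ, HeisSpace n)) 𝓘(ℝ, HeisSpace n) ∞
        (fun p : Heis n × Heis n => (p.1 : HeisSpace n)) := contMDiff_fst
    have h2 : ContMDiff (𝓘(ℝ, HeisSpace n).prod 𝓘(ℝ, HeisSpace n)) 𝓘(ℝ, HeisSpace n) ∞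
        (fun p : Heis n × Heis n => (p.2 : HeisSpace n)) := contMDiff_snd
    exact contDiff_mul.comp_contMDiff (h1.prodMk_space h2)
  contMDiff_inv := (contDiff_inv (n := n)).contMDiff

instance : IsTopologicalGroup (Heis n) :=
  topologicalGroup_of_lieGroup 𝓘(ℝ, HeisSpace n) ∞

theorem simplyConnectedSpace : SimplyConnectedSpace (Heis n) :=
  inferInstanceAs (SimplyConnectedSpace (HeisSpace n))

/-- The abelianization `(x, y, z) ↦ (x, y)`. -/
def toAb : Heis n →* Multiplicative ((Fin n → ℝ) × (Fin n → ℝ)) where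
  toFun g := Multiplicative.ofAdd (g.x, g.y)
  map_one' := rfl
  map_mul' _ _ := rfl

theorem isNilpotent : Group.IsNilpotent (Heis n) := by
  refine Subgroup.isNilpotent_of_ker_le_center toAb (fun g hg => ?_)
  have hg' : (g.x, g.y) = (0, 0) := hg
  rw [Prod.mk.injEq] at hg'
  refine Subgroup.mem_center_iff.2 fun h => ext' ?_ ?_ ?_
  · simp [add_comm]
  · simp [add_comm]
  · simp [hg'.1, hg'.2, add_comm]

/-! ### The lattice -/

theorem mem_lattice_iff {g : Heis n} : g ∈ lattice n ↔ ∃ (k l : Fin n → ℤ) (m : ℤ),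
    g = mk (fun i => (k i : ℝ)) (fun i => (l i : ℝ)) m := by
  constructor
  · rintro ⟨hx, hy, m, hm⟩
    choose k hk using hx
    choose l hl using hy
    exact ⟨k, l, m, ext' (funext hk) (funext hl) hm⟩
  · rintro ⟨k, l, m, rfl⟩
    exact ⟨fun i => ⟨k i, rfl⟩, fun i => ⟨l i, rfl⟩, m, rfl⟩

theorem eq_one_of_mem_lattice {g : Heis n} (hg : g ∈ lattice n) (hx : ∀ i, |g.x i| < 1)
    (hy : ∀ i, |g.y i| < 1) (hz : |g.z| < 1) : g = 1 := by
  obtain ⟨k, l, m, rfl⟩ := mem_lattice_iff.1 hg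
  have key : ∀ j : ℤ, |(j : ℝ)| < 1 → (j : ℝ) = 0 := fun j hj => by
    have : |j| < 1 := by exact_mod_cast hj
    rw [Int.abs_lt_one_iff] at this
    simp [this]
  exact ext' (funext fun i => key _ (hx i)) (funext fun i => key _ (hy i)) (key _ hz)

theorem isOpen_box : IsOpen {g : Heis n | (∀ i, |g.x i| < 1) ∧ (∀ i, |g.y i| < 1) ∧ |g.z| < 1} := by
  have hx : ∀ i, Continuous fun g : Heis n => |g.x i| := fun i =>
    ((continuous_apply i).comp continuous_x).abs
  have hy : ∀ i, Continuous fun g : Heis n => |g.y i| := fun i =>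
    ((continuous_apply i).comp continuous_y).abs
  simp only [Set.ofPred_and, Set.ofPred_forall]
  exact (isOpen_iInter_of_finite fun i => isOpen_lt (hx i) continuous_const).inter
    ((isOpen_iInter_of_finite fun i => isOpen_lt (hy i) continuous_const).inter
      (isOpen_lt continuous_z.abs continuous_const))

/-- The open unit box isolates the identity among integer points. The form with a homomorphism `f`
serves both the lattice and its intersection with a subgroup. -/
theorem discreteTopology_of_subset_lattice {K : Type*} [Group K] [TopologicalSpace K]
    [IsTopologicalGroup K] {f : K →* Heis n} (hf : Continuous f) (hinj : Function.Injective f)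
    (hK : ∀ k, f k ∈ lattice n) : DiscreteTopology K := by
  refine discreteTopology_of_isOpen_singleton_one ?_
  convert (isOpen_box (n := n)).preimage hf
  ext k
  constructor
  · rintro rfl
    simp
  · rintro ⟨h1, h2, h3⟩
    exact hinj ((eq_one_of_mem_lattice (hK k) h1 h2 h3).trans (map_one f).symm)

instance : DiscreteTopology (lattice n) :=
  discreteTopology_of_subset_lattice (f := (lattice n).subtype) continuous_subtype_val
    Subtype.val_injective fun k => k.2

/-- Every element can be moved into the unit cube by the lattice. -/
theorem exists_mul_lattice_mem_cube (g : Heis n) : ∃ γ ∈ lattice n, (γ.x = fun i => -(⌊g.x i⌋ : ℝ)) ∧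
    (∀ i, (g * γ).x i ∈ Set.Icc (0 : ℝ) 1) ∧ (∀ i, (g * γ).y i ∈ Set.Icc (0 : ℝ) 1) ∧
    (g * γ).z ∈ Set.Icc (0 : ℝ) 1 := by
  set k : Fin n → ℤ := fun i => -⌊g.x i⌋
  set l : Fin n → ℤ := fun i => -⌊g.y i⌋
  -- Correcting `x` and `y` changes `z`, so the central correction is read off afterwards. The
  -- formula for `γ.x` shows that `γ` has `x = 0` if `g` does, as is needed for the cocompactness in
  -- `vertical`.
  set r : ℝ := (g * mk (fun i => (k i : ℝ)) (fun i => (l i : ℝ)) 0).z with hr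
  have hfl : ∀ u : ℝ, u + ((-⌊u⌋ : ℤ) : ℝ) ∈ Set.Icc (0 : ℝ) 1 := fun u => by
    push_cast
    constructor
    · linarith [Int.floor_le u]
    · linarith [Int.lt_floor_add_one u]
  refine ⟨mk (fun i => (k i : ℝ)) (fun i => (l i : ℝ)) ((-⌊r⌋ : ℤ) : ℝ),
    mem_lattice_iff.2 ⟨k, l, _, rfl⟩, ?_, fun i => hfl _, fun i => hfl _, ?_⟩
  · funext i; simp [k]
  · convert hfl r using 1
    simp only [hr, mul_z, mk_x, mk_y, mk_z]
    ring

theorem isCompact_cube : IsCompact {g : Heis n | (∀ i, g.x i ∈ Set.Icc (0 : ℝ) 1) ∧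
    (∀ i, g.y i ∈ Set.Icc (0 : ℝ) 1) ∧ g.z ∈ Set.Icc (0 : ℝ) 1} := by
  have h : IsCompact ((Set.univ.pi fun _ : Fin n => Set.Icc (0 : ℝ) 1) ×ˢ
      ((Set.univ.pi fun _ : Fin n => Set.Icc (0 : ℝ) 1) ×ˢ Set.Icc (0 : ℝ) 1)) :=
    (isCompact_univ_pi fun _ => isCompact_Icc).prod
      ((isCompact_univ_pi fun _ => isCompact_Icc).prod isCompact_Icc)
  have e : {g : HeisSpace n | (∀ i, g.1 i ∈ Set.Icc (0 : ℝ) 1) ∧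
      (∀ i, g.2.1 i ∈ Set.Icc (0 : ℝ) 1) ∧ g.2.2 ∈ Set.Icc (0 : ℝ) 1} =
      (Set.univ.pi fun _ : Fin n => Set.Icc (0 : ℝ) 1) ×ˢ
      ((Set.univ.pi fun _ : Fin n => Set.Icc (0 : ℝ) 1) ×ˢ Set.Icc (0 : ℝ) 1) := by
    ext g
    simp only [Set.mem_prod, Set.mem_univ_pi, Set.mem_ofPred_eq]
  rw [← e] at h
  exact h

theorem compactSpace_quotient {K : Type*} [Group K] [TopologicalSpace K] {Λ : Subgroup K}
    {C : Set K} (hC : IsCompact C) (h : ∀ g : K, ∃ γ ∈ Λ, g * γ ∈ C) : CompactSpace (K ⧸ Λ) := by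
  refine ⟨?_⟩
  convert hC.image (f := ((↑) : K → K ⧸ Λ)) continuous_quotient_mk'
  refine (Set.eq_univ_of_forall fun p => ?_).symm
  obtain ⟨g, rfl⟩ := QuotientGroup.mk_surjective p
  obtain ⟨γ, hγ, hg⟩ := h g
  exact ⟨_, hg, QuotientGroup.mk_mul_of_mem g hγ⟩

instance : CompactSpace (HeisNil n) :=
  compactSpace_quotient isCompact_cube fun g => by
    obtain ⟨γ, hγ, -, h⟩ := exists_mul_lattice_mem_cube g
    exact ⟨γ, hγ, h⟩

theorem isCocompactLattice_lattice : IsCocompactLattice (lattice n) :=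
  ⟨inferInstance, inferInstance⟩

/-! ### The normal subgroup `x = 0` -/

/-- The normal subgroup of the elements `(0, y, z)`. -/
def vertical (n : ℕ) : Subgroup (Heis n) where
  carrier := {g | g.x = 0}
  one_mem' := rfl
  mul_mem' := fun {g h} hg hh => by
    change g.x = 0 at hg
    change h.x = 0 at hh
    change (g * h).x = 0
    simp [hg, hh]
  inv_mem' := fun {g} hg => by
    change g.x = 0 at hg
    change g⁻¹.x = 0
    simp [hg]

theorem mem_vertical {g : Heis n} : g ∈ vertical n ↔ g.x = 0 := Iff.rfl

theorem normal_vertical : (vertical n).Normal :=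
  ⟨fun g hg h => by
    rw [mem_vertical] at hg ⊢
    simp [hg]⟩

theorem isClosed_vertical : IsClosed (vertical n : Set (Heis n)) :=
  isClosed_eq continuous_x continuous_const

theorem isConnected_vertical : IsConnected (vertical n : Set (Heis n)) := by
  have h : (vertical n : Set (Heis n)) =
      Set.range fun p : (Fin n → ℝ) × ℝ => mk 0 p.1 p.2 := by
    ext g
    constructor
    · intro hg
      exact ⟨(g.y, g.z), ext' (mem_vertical.1 hg).symm rfl rfl⟩
    · rintro ⟨p, rfl⟩
      exact (mem_vertical.2 rfl)
  rw [h]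
  exact isConnected_range (continuous_mk continuous_const continuous_fst continuous_snd)

theorem isRationalSubgroup_vertical : IsRationalSubgroup (lattice n) (vertical n) := by
  refine ⟨isClosed_vertical, isConnected_vertical, ?_, ?_⟩
  · exact discreteTopology_of_subset_lattice
      (f := (vertical n).subtype.comp ((lattice n).subgroupOf (vertical n)).subtype)
      (continuous_subtype_val.comp continuous_subtype_val)
      (Subtype.val_injective.comp Subtype.val_injective) fun k => k.2
  · refine compactSpace_quotient (C := Subtype.val ⁻¹' {g : Heis n |
      (∀ i, g.x i ∈ Set.Icc (0 : ℝ) 1) ∧ (∀ i, g.y i ∈ Set.Icc (0 : ℝ) 1) ∧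
        g.z ∈ Set.Icc (0 : ℝ) 1}) ?_ fun g => ?_
    · exact isClosed_vertical.isClosedEmbedding_subtypeVal.isCompact_preimage isCompact_cube
    · obtain ⟨γ, hγ, hx, h⟩ := exists_mul_lattice_mem_cube (g : Heis n)
      refine ⟨⟨γ, ?_⟩, hγ, h⟩
      rw [mem_vertical, hx, mem_vertical.1 g.2]
      funext i
      simp

end Heis

namespace HeisExample

open Matrix Heis

/-! ### The action on the Heisenberg nilmanifold -/

theorem toR_inv_mul (U : IntMatˣ) : toR (U⁻¹ : IntMatˣ) * toR U = 1 := by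
  rw [toR, toR, ← map_mul, Units.inv_mul, map_one]

/-- `(x, y, z) ↦ (U x, U⁻ᵀ y, z)`. -/
def autMap (U : IntMatˣ) (g : Heis 6) : Heis 6 :=
  Heis.mk (toR U *ᵥ g.x) (g.y ᵥ* toR (U⁻¹ : IntMatˣ)) g.z

/-- The contragredient action on `y` preserves the pairing, hence the multiplication while `z` is
left fixed. -/
theorem dotProduct_autMap (U : IntMatˣ) (x y : Fin 6 → ℝ) :
    (toR U *ᵥ x) ⬝ᵥ (y ᵥ* toR (U⁻¹ : IntMatˣ)) = x ⬝ᵥ y := by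
  rw [dotProduct_comm, ← dotProduct_mulVec, mulVec_mulVec, toR_inv_mul, one_mulVec,
    dotProduct_comm]

theorem autMap_mul (U V : IntMatˣ) (g : Heis 6) : autMap (U * V) g = autMap U (autMap V g) := by
  refine Heis.ext' ?_ ?_ rfl
  · simp only [autMap, mk_x, mulVec_mulVec]
    rw [toR, toR, toR, ← map_mul, ← Units.val_mul]
  · simp only [autMap, mk_y, vecMul_vecMul]
    rw [toR, toR, toR, ← map_mul, _root_.mul_inv_rev, Units.val_mul]

theorem autMap_one (g : Heis 6) : autMap 1 g = g := by
  refine Heis.ext' ?_ ?_ rfl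
  · simp [autMap]
  · simp [autMap]

/-- The automorphisms `(x, y, z) ↦ (U x, U⁻ᵀ y, z)`. -/
def heisAut : IntMatˣ →* MulAut (Heis 6) where
  toFun U :=
    { toFun := autMap U
      invFun := autMap U⁻¹
      left_inv := fun g => by rw [← autMap_mul, inv_mul_cancel, autMap_one]
      right_inv := fun g => by rw [← autMap_mul, mul_inv_cancel, autMap_one]
      map_mul' := fun g h => by
        refine Heis.ext' ?_ ?_ ?_
        · simp [autMap, mulVec_add]
        · simp [autMap, add_vecMul]
        · simp only [autMap, mul_x, mul_y, mul_z, mk_x, mk_y, mk_z, dotProduct_autMap] }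
  map_one' := MulEquiv.ext autMap_one
  map_mul' U V := MulEquiv.ext (autMap_mul U V)

theorem continuous_autMap (U : IntMatˣ) : Continuous (autMap U) :=
  continuous_mk (continuous_const.matrix_mulVec continuous_x)
    (continuous_y.matrix_vecMul continuous_const) continuous_z

theorem autMap_mem_lattice (U : IntMatˣ) {g : Heis 6} (hg : g ∈ lattice 6) :
    autMap U g ∈ lattice 6 := by
  obtain ⟨k, l, m, rfl⟩ := mem_lattice_iff.1 hg
  refine mem_lattice_iff.2 ⟨(U : IntMat) *ᵥ k, l ᵥ* ((U⁻¹ : IntMatˣ) : IntMat), m,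
    Heis.ext' (funext fun i => ?_) (funext fun i => ?_) rfl⟩
  · simp [autMap, mulVec, dotProduct]
  · simp [autMap, vecMul, dotProduct]

/-- The action of `ℤ²` on the Heisenberg nilmanifold. -/
def heisAction : NilAction (Multiplicative (ℤ × ℤ)) (lattice 6) where
  lift := heisAut.comp unitHom
  continuous_lift a := continuous_autMap (unitHom a)
  invariant_lattice a _ g := by
    refine ⟨fun h => ?_, autMap_mem_lattice (unitHom a)⟩
    have := autMap_mem_lattice (unitHom a)⁻¹ h
    have h2 : autMap (unitHom a)⁻¹ (autMap (unitHom a) g) = g := by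
      rw [← autMap_mul, inv_mul_cancel, autMap_one]
    change autMap (unitHom a)⁻¹ (autMap (unitHom a) g) ∈ lattice 6 at this
    rwa [h2] at this

theorem heisAction_lift (a : Multiplicative (ℤ × ℤ)) (g : Heis 6) :
    heisAction.lift a g = autMap (unitHom a) g := rfl

/-! ### The factor on the torus -/

theorem isFactorSubgroup_vertical : heisAction.IsFactorSubgroup (vertical 6) where
  normal := normal_vertical
  rational := isRationalSubgroup_vertical
  invariant a _ g := by
    rw [heisAction_lift, mem_vertical, mem_vertical]
    refine ⟨fun h => ?_, fun h => by simp [autMap, h]⟩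
    have h1 := congrArg (toR ((unitHom a)⁻¹ : IntMatˣ) *ᵥ ·) h
    simpa only [autMap, mk_x, mulVec_mulVec, toR_inv_mul, one_mulVec, mulVec_zero] using h1

theorem toTorus_eq_zero_iff {x : Fin 6 → ℝ} :
    toTorus x = 0 ↔ ∃ k : Fin 6 → ℤ, x = fun i => (k i : ℝ) := by
  have := toTorus_eq_iff (x := 0) (y := x)
  simp only [zero_add] at this
  rw [← this, eq_comm]
  rfl

theorem mem_vertical_sup_lattice {g : Heis 6} :
    g ∈ vertical 6 ⊔ lattice 6 ↔ toTorus g.x = 0 := by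
  constructor
  · let K : Subgroup (Heis 6) :=
      { carrier := {g | toTorus g.x = 0}
        one_mem' := rfl
        mul_mem' := fun {g h} hg hh => by
          change toTorus g.x = 0 at hg
          change toTorus h.x = 0 at hh
          change toTorus (g.x + h.x) = 0
          rw [toTorus_add, hg, hh, add_zero]
        inv_mem' := fun {g} hg => by
          change toTorus g.x = 0 at hg
          change -toTorus g.x = 0
          rw [hg, neg_zero] }
    have h : vertical 6 ⊔ lattice 6 ≤ K := by
      refine sup_le (fun g hg => ?_) fun g hg => ?_
      · change toTorus g.x = 0
        rw [mem_vertical.1 hg]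
        rfl
      · obtain ⟨k, l, m, rfl⟩ := mem_lattice_iff.1 hg
        exact toTorus_eq_zero_iff.2 ⟨k, rfl⟩
    exact fun hg => h hg
  · intro hg
    obtain ⟨k, hk⟩ := toTorus_eq_zero_iff.1 hg
    set γ : Heis 6 := Heis.mk (fun i => (k i : ℝ)) 0 0
    have hγ : γ ∈ lattice 6 := mem_lattice_iff.2 ⟨k, 0, 0, Heis.ext' rfl
      (funext fun i => by simp [γ]) (by simp [γ])⟩
    have hv : g * γ⁻¹ ∈ vertical 6 := by
      rw [mem_vertical]; simp [γ, hk]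
    have := Subgroup.mul_mem_sup hv hγ
    rwa [inv_mul_cancel_right] at this

/-- The map of `X / H` onto the torus induced by the coordinate `x`. -/
def baseMap : Heis 6 ⧸ (vertical 6 ⊔ lattice 6) → Torus 6 :=
  Quotient.lift (fun g : Heis 6 => toTorus g.x) fun g h hgh => by
    have h1 := mem_vertical_sup_lattice.1 (QuotientGroup.leftRel_apply.1 hgh)
    have h2 : toTorus h.x - toTorus g.x = 0 := by
      rw [← h1, mul_x, inv_x, toTorus_add, sub_eq_neg_add]
      rfl
    exact (sub_eq_zero.1 h2).symm

theorem baseMap_mk (g : Heis 6) :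
    baseMap (g : Heis 6 ⧸ (vertical 6 ⊔ lattice 6)) = toTorus g.x := rfl

theorem bijective_baseMap : Function.Bijective baseMap := by
  constructor
  · intro p q
    obtain ⟨g, rfl⟩ := QuotientGroup.mk_surjective p
    obtain ⟨h, rfl⟩ := QuotientGroup.mk_surjective q
    intro hgh
    rw [baseMap_mk, baseMap_mk] at hgh
    refine QuotientGroup.eq.2 (mem_vertical_sup_lattice.2 ?_)
    have : toTorus (g⁻¹ * h).x = -toTorus g.x + toTorus h.x := rfl
    rw [this, hgh, neg_add_cancel]
  · intro t
    obtain ⟨x, rfl⟩ := surjective_toTorus t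
    exact ⟨(Heis.mk x 0 0 : Heis 6), rfl⟩

theorem continuous_baseMap : Continuous baseMap :=
  (continuous_toTorus.comp continuous_x).quotient_lift _

instance : CompactSpace (Heis 6 ⧸ (vertical 6 ⊔ lattice 6)) :=
  compactSpace_quotient isCompact_cube fun g => by
    obtain ⟨γ, hγ, -, h⟩ := exists_mul_lattice_mem_cube g
    exact ⟨γ, Subgroup.mem_sup_right hγ, h⟩

/-- The identification of `X / H` with the torus. -/
noncomputable def baseHomeo : (Heis 6 ⧸ (vertical 6 ⊔ lattice 6)) ≃ₜ Torus 6 :=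
  Continuous.homeoOfEquivCompactToT2 (f := Equiv.ofBijective baseMap bijective_baseMap)
    continuous_baseMap

theorem baseHomeo_mk (g : Heis 6) :
    baseHomeo (g : Heis 6 ⧸ (vertical 6 ⊔ lattice 6)) = toTorus g.x := rfl

theorem transportAction_baseHomeo (a : Multiplicative (ℤ × ℤ)) (t : Torus 6) :
    transportAction baseHomeo (heisAction.factorAction isFactorSubgroup_vertical) a t =
      torusMap (unitHom a : IntMat) t := by
  obtain ⟨p, rfl⟩ := baseHomeo.surjective t
  obtain ⟨g, rfl⟩ := QuotientGroup.mk_surjective p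
  have : transportAction baseHomeo (heisAction.factorAction isFactorSubgroup_vertical) a
      (baseHomeo (g : Heis 6 ⧸ (vertical 6 ⊔ lattice 6))) =
      baseHomeo (heisAction.factorAction isFactorSubgroup_vertical a
        (baseHomeo.symm (baseHomeo (g : Heis 6 ⧸ (vertical 6 ⊔ lattice 6))))) := rfl
  rw [this, Homeomorph.symm_apply_apply, baseHomeo_mk, torusMap_toTorus]
  rfl

/-- Reduces every claim about finite index subgroups to a single nontrivial power of `A`. -/
theorem exists_pow_fst_mem {S : Subgroup (Multiplicative (ℤ × ℤ))} (hS : S.FiniteIndex) :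
    ∃ m : ℕ, m ≠ 0 ∧ Multiplicative.ofAdd ((m : ℤ), (0 : ℤ)) ∈ S := by
  obtain ⟨m, hm, -, h⟩ := Subgroup.exists_pow_mem_of_index_ne_zero hS.index_ne_zero
    (Multiplicative.ofAdd ((1 : ℤ), (0 : ℤ)))
  refine ⟨m, hm.ne', ?_⟩
  rw [← ofAdd_nsmul] at h
  simpa using h

theorem isTotallyIrreducible_base : IsTotallyIrreducible
    (transportAction baseHomeo (heisAction.factorAction isFactorSubgroup_vertical)) := by
  intro S hS T hc hconn hT
  obtain ⟨m, hm, hmS⟩ := exists_pow_fst_mem hS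
  refine eq_bot_or_top_of_torusMap_mem hm hc hconn fun t ht => ?_
  rw [← transportAction_baseHomeo]
  have := hT _ hmS
  exact this.subset ⟨t, ht, rfl⟩

/-! ### Algebraic factors are not virtually cyclic -/

open scoped IsMulCommutative in
theorem not_isVirtuallyCyclic_of_injective {X : Type} [TopologicalSpace X]
    {ρ : Multiplicative (ℤ × ℤ) →* (X ≃ₜ X)} (h : ∀ a, ρ a = 1 → a = 1) :
    ¬ IsVirtuallyCyclic ρ := by
  intro hv
  let f : (ℤ × ℤ) →+ Additive ρ.range := MonoidHom.toAdditiveRight ρ.rangeRestrict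
  have hf : Function.Injective f.toIntLinearMap := by
    refine (injective_iff_map_eq_zero f).2 fun a ha => ?_
    have h1 : ρ (Multiplicative.ofAdd a) = 1 := congrArg Subtype.val (congrArg Additive.toMul ha)
    exact Multiplicative.ofAdd.injective (h _ h1)
  have h2 := (LinearMap.rank_le_of_injective f.toIntLinearMap hf).trans hv
  rw [rank_prod', Module.rank_self] at h2
  norm_num at h2

theorem exists_mulVec_sub_eq {M : IntMat} (hM : (M - 1).det ≠ 0) (x : Fin 6 → ℝ) :
    ∃ v, toR M *ᵥ v - v = x := by
  have hdet : IsUnit ((Int.castRingHom ℝ).mapMatrix (M - 1)).det := by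
    rw [← RingHom.map_det]
    simpa using hM
  refine ⟨((Int.castRingHom ℝ).mapMatrix (M - 1))⁻¹ *ᵥ x, ?_⟩
  have h : ∀ v, toR M *ᵥ v - v = ((Int.castRingHom ℝ).mapMatrix (M - 1)) *ᵥ v := fun v => by
    rw [map_sub, map_one, sub_mulVec, one_mulVec]
  rw [h, mulVec_mulVec, mul_nonsing_inv _ hdet, one_mulVec]

theorem exists_vecMul_sub_eq {M : IntMat} (hM : (M - 1).det ≠ 0) (x : Fin 6 → ℝ) :
    ∃ v, v ᵥ* toR M - v = x := by
  have hdet : IsUnit ((Int.castRingHom ℝ).mapMatrix (M - 1)).det := by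
    rw [← RingHom.map_det]
    simpa using hM
  refine ⟨x ᵥ* ((Int.castRingHom ℝ).mapMatrix (M - 1))⁻¹, ?_⟩
  have h : ∀ v, v ᵥ* toR M - v = v ᵥ* ((Int.castRingHom ℝ).mapMatrix (M - 1)) := fun v => by
    rw [map_sub, map_one, vecMul_sub, vecMul_one]
  rw [h, vecMul_vecMul, nonsing_inv_mul _ hdet, vecMul_one]

end HeisExample

/-! ### Closed subgroups that are large in the abelianization -/

namespace Heis

open Matrix

variable {n : ℕ}

/-- The image of a subgroup in the abelianization `ℝⁿ × ℝⁿ`. -/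
def abImage (H : Subgroup (Heis n)) : AddSubgroup ((Fin n → ℝ) × (Fin n → ℝ)) where
  carrier := {v | ∃ h ∈ H, (h.x, h.y) = v}
  zero_mem' := ⟨1, H.one_mem, rfl⟩
  add_mem' := by
    rintro _ _ ⟨g, hg, rfl⟩ ⟨h, hh, rfl⟩
    exact ⟨g * h, H.mul_mem hg hh, rfl⟩
  neg_mem' := by
    rintro _ ⟨g, hg, rfl⟩
    exact ⟨g⁻¹, H.inv_mem hg, rfl⟩

/-- A subgroup that maps onto the abelianization is everything. -/
theorem eq_top_of_abImage_eq_top (hn : 0 < n) {H : Subgroup (Heis n)} (h : abImage H = ⊤) :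
    H = ⊤ := by
  have hab : ∀ x y : Fin n → ℝ, ∃ g ∈ H, g.x = x ∧ g.y = y := fun x y => by
    obtain ⟨g, hg, e⟩ : (x, y) ∈ abImage H := h ▸ AddSubgroup.mem_top _
    exact ⟨g, hg, (Prod.mk.injEq .. ▸ e).1, (Prod.mk.injEq .. ▸ e).2⟩
  -- The commutator of elements over `(a, 0)` and `(0, b)` is `(0, 0, 2 a·b)`, whence `s / 2`.
  have hcentral : ∀ s : ℝ, mk 0 0 s ∈ H := fun s => by
    obtain ⟨g, hg, hgx, hgy⟩ := hab (Pi.single ⟨0, hn⟩ (s / 2)) 0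
    obtain ⟨k, hk, hkx, hky⟩ := hab 0 (Pi.single ⟨0, hn⟩ 1)
    have : mk 0 0 s = (k * g)⁻¹ * (g * k) := by
      refine ext' ?_ ?_ ?_
      · simp [hgx, hkx]
      · simp [hgy, hky]
      · simp [hgx, hkx, hgy, hky]
        ring
    rw [this]
    exact H.mul_mem (H.inv_mem (H.mul_mem hk hg)) (H.mul_mem hg hk)
  refine (Subgroup.eq_top_iff' H).2 fun g => ?_
  obtain ⟨k, hk, hkx, hky⟩ := hab g.x g.y
  have : g = k * mk 0 0 (g.z - k.z) := ext' (by simp [hkx]) (by simp [hky]) (by simp)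
  rw [this]
  exact H.mul_mem hk (hcentral _)

/-- A closed subgroup whose image in the abelianization has countable index is everything. -/
theorem eq_top_of_countable_cover (hn : 0 < n) {H : Subgroup (Heis n)}
    (hH : IsClosed (H : Set (Heis n))) {ι : Type*} [Countable ι]
    (c : ι → (Fin n → ℝ) × (Fin n → ℝ))
    (hcov : ∀ v, ∃ i, v - c i ∈ abImage H) : H = ⊤ := by
  set π : Heis n → (Fin n → ℝ) × (Fin n → ℝ) := fun g => (g.x, g.y)
  have hπ : Continuous π := continuous_x.prodMk continuous_y
  -- The image of `H` need not be closed a priori, but it is a countable union of compact sets. By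
  -- Baire's theorem one translate of a piece has interior, so the image is an open subgroup of a
  -- connected group.
  set K : ℕ → Set ((Fin n → ℝ) × (Fin n → ℝ)) := fun m => π '' (H ∩ compactCovering (Heis n) m)
  have hK : ∀ m, IsCompact (K m) := fun m =>
    ((isCompact_compactCovering (Heis n) m).inter_left hH).image hπ
  have hKsub : ∀ m, K m ⊆ abImage H := by
    rintro m _ ⟨g, ⟨hg, -⟩, rfl⟩
    exact ⟨g, hg, rfl⟩
  set F : ℕ × ι → Set ((Fin n → ℝ) × (Fin n → ℝ)) := fun p => (fun v => v - c p.2) ⁻¹' K p.1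
  have hF : ∀ p, IsClosed (F p) := fun p =>
    (hK p.1).isClosed.preimage (continuous_id.sub continuous_const)
  have hU : ⋃ p, F p = Set.univ := by
    refine Set.eq_univ_of_forall fun v => ?_
    obtain ⟨i, g, hg, e⟩ := hcov v
    obtain ⟨m, hm⟩ : ∃ m, g ∈ compactCovering (Heis n) m := by
      have : g ∈ ⋃ m, compactCovering (Heis n) m := by
        rw [iUnion_compactCovering]; trivial
      exact Set.mem_iUnion.1 this
    exact Set.mem_iUnion.2 ⟨(m, i), g, ⟨hg, hm⟩, e⟩
  obtain ⟨p, v, hv⟩ := nonempty_interior_of_iUnion_of_closed hF hU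
  have hnhds : (abImage H : Set _) ∈ nhds (v - c p.2) := by
    have h1 : F p ∈ nhds ((v - c p.2) + c p.2) := by
      rw [sub_add_cancel]; exact mem_interior_iff_mem_nhds.1 hv
    have h2 : (fun u => u + c p.2) ⁻¹' F p ∈ nhds (v - c p.2) :=
      (continuous_id.add continuous_const).continuousAt.preimage_mem_nhds h1
    refine Filter.mem_of_superset h2 fun u hu => ?_
    have h3 : u + c p.2 - c p.2 ∈ K p.1 := hu
    rw [add_sub_cancel_right] at h3
    exact hKsub _ h3
  have hopen : IsOpen (abImage H : Set ((Fin n → ℝ) × (Fin n → ℝ))) :=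
    (abImage H).isOpen_of_mem_nhds hnhds
  have huniv := IsClopen.eq_univ ⟨(abImage H).isClosed_of_isOpen hopen, hopen⟩
    ⟨0, (abImage H).zero_mem⟩
  exact eq_top_of_abImage_eq_top hn (SetLike.coe_injective huniv)

end Heis

namespace HeisExample

open Matrix Heis

/-- If `a ≠ 1` acts trivially on `X / H`, all `g⁻¹ α(a)(g)` lie in `HΓ`. As `a` has no eigenvalue
`1`, these elements cover the abelianization, so the image of `H` there has countable index. -/
theorem hasNoVirtuallyCyclicFactor_heisAction : heisAction.HasNoVirtuallyCyclicFactor := by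
  intro H hH hne
  refine not_isVirtuallyCyclic_of_injective fun a ha => ?_
  by_contra ha1
  apply hne
  have := hH.normal
  have hmem : ∀ g : Heis 6, g⁻¹ * autMap (unitHom a) g ∈ H ⊔ lattice 6 := fun g => by
    have h1 : heisAction.factorAction hH a (g : Heis 6 ⧸ (H ⊔ lattice 6)) =
        (g : Heis 6 ⧸ (H ⊔ lattice 6)) := by rw [ha]; rfl
    exact QuotientGroup.eq.1 h1.symm
  refine eq_top_of_countable_cover (by norm_num) hH.rational.1
    (ι := (Fin 6 → ℤ) × (Fin 6 → ℤ))
    (fun p => (fun i => (p.1 i : ℝ), fun i => (p.2 i : ℝ))) fun v => ?_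
  obtain ⟨x, hx⟩ := exists_mulVec_sub_eq (det_unitHom_sub_one_ne_zero ha1) v.1
  obtain ⟨y, hy⟩ := exists_vecMul_sub_eq
    (det_unitHom_sub_one_ne_zero (a := a⁻¹) (inv_ne_one.2 ha1)) v.2
  have h1 := hmem (Heis.mk x y 0)
  rw [← SetLike.mem_coe, Subgroup.normal_mul] at h1
  obtain ⟨h, hh, γ, hγ, e⟩ := Set.mem_mul.1 h1
  obtain ⟨k, l, m, rfl⟩ := mem_lattice_iff.1 hγ
  refine ⟨(k, l), h, hh, ?_⟩
  have ex := congrArg Heis.x e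
  have ey := congrArg Heis.y e
  simp only [mul_x, mul_y, inv_x, inv_y, mk_x, mk_y, autMap] at ex ey
  rw [map_inv] at hy
  refine Prod.ext ?_ ?_
  · rw [Prod.fst_sub, ← hx, eq_sub_iff_add_eq, sub_eq_neg_add]
    exact ex
  · rw [Prod.snd_sub, ← hy, eq_sub_iff_add_eq, sub_eq_neg_add]
    exact ey

end HeisExample

namespace HeisExample

open Matrix Heis

/-! ### The invariant measure -/

theorem exists_toCircle_eq {c : ℂ} (hc : ‖c‖ = 1) :
    ∃ θ : UnitAddCircle, (θ.toCircle : ℂ) = c := by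
  obtain ⟨θ, hθ⟩ := (AddCircle.homeomorphCircle (T := 1) one_ne_zero).surjective
    ⟨c, mem_sphere_zero_iff_norm.2 hc⟩
  refine ⟨θ, ?_⟩
  rw [AddCircle.homeomorphCircle_apply] at hθ
  rw [hθ]

/-- The circle `θ ↦ Re (e(θ) ξ)` in `ℝ⁶`. -/
noncomputable def curve (ξ : Fin 6 → ℂ) (θ : UnitAddCircle) : Fin 6 → ℝ :=
  fun i => ((θ.toCircle : ℂ) * ξ i).re

theorem continuous_curve (ξ : Fin 6 → ℂ) : Continuous (curve ξ) :=
  continuous_pi fun _ => Complex.continuous_re.comp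
    ((continuous_subtype_val.comp AddCircle.continuous_toCircle).mul continuous_const)

theorem abs_curve_le {ξ : Fin 6 → ℂ} {r : ℝ} (hξ : ∀ i, ‖ξ i‖ ≤ r) (θ : UnitAddCircle)
    (i : Fin 6) : |curve ξ θ i| ≤ r := by
  refine (Complex.abs_re_le_norm _).trans ?_
  rw [norm_mul, Circle.norm_coe, one_mul]
  exact hξ i

theorem exists_curve_eq_neg (ξ : Fin 6 → ℂ) (θ : UnitAddCircle) :
    ∃ θ', curve ξ θ' = -curve ξ θ := by
  obtain ⟨θ', h⟩ := exists_toCircle_eq (c := -(θ.toCircle : ℂ))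
    (by rw [norm_neg, Circle.norm_coe])
  exact ⟨θ', funext fun i => by simp [curve, h]⟩

theorem exists_curve_ne_zero {ξ : Fin 6 → ℂ} (hξ : ξ ≠ 0) : ∃ θ i, curve ξ θ i ≠ 0 := by
  obtain ⟨i, hi⟩ := Function.ne_iff.1 hξ
  by_cases h : (ξ i).re = 0
  · obtain ⟨θ, hθ⟩ := exists_toCircle_eq (c := Complex.I) (by simp)
    refine ⟨θ, i, fun h1 => hi (Complex.ext h ?_)⟩
    simpa [curve, hθ] using h1
  · obtain ⟨θ, hθ⟩ := exists_toCircle_eq (c := 1) (by simp)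
    exact ⟨θ, i, by simpa [curve, hθ] using h⟩

/-- A real matrix commutes with taking real parts, so multiplying `ξ` by a unimodular number amounts
to turning the parameter. -/
theorem curve_vecMul {ξ : Fin 6 → ℂ} {M : IntMat} {c : ℂ} (h : ξ ᵥ* toC M = c • ξ)
    {β : UnitAddCircle} (hβ : (β.toCircle : ℂ) = c) (θ : UnitAddCircle) :
    curve ξ θ ᵥ* toR M = curve ξ (θ + β) := by
  funext j
  have h1 : ∑ i, ξ i * (M i j : ℂ) = c * ξ j := by
    simpa [vecMul, dotProduct] using congrFun h j
  have h2 : (θ.toCircle : ℂ) * c * ξ j = ∑ i, (θ.toCircle : ℂ) * ξ i * (M i j : ℂ) := by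
    rw [mul_assoc, ← h1, Finset.mul_sum]
    exact Finset.sum_congr rfl fun i _ => by ring
  simp only [curve, AddCircle.toCircle_add, Circle.coe_mul, hβ, h2, Complex.re_sum, vecMul,
    dotProduct, RingHom.mapMatrix_apply, Matrix.map_apply]
  refine Finset.sum_congr rfl fun i _ => ?_
  rw [← Complex.ofReal_intCast, Complex.re_mul_ofReal]
  simp

/-- The point `(0, w, 0) (x, 0, 0) Γ` of the nilmanifold. -/
def nilPoint (x w : Fin 6 → ℝ) : HeisNil 6 := (Heis.mk x w (-(x ⬝ᵥ w)) : Heis 6)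

/-- Right multiplication by `(k, 0, 0) ∈ Γ` takes `(x, w, -x·w)` to the same expression at `x + k`.
-/
theorem nilPoint_add_int (x w : Fin 6 → ℝ) (k : Fin 6 → ℤ) :
    nilPoint (x + fun i => (k i : ℝ)) w = nilPoint x w := by
  refine (QuotientGroup.eq.2 (mem_lattice_iff.2 ⟨k, 0, 0, Heis.ext' ?_ ?_ ?_⟩)).symm
  · simp
  · funext i; simp
  · simp [add_dotProduct, neg_dotProduct]

theorem nilPoint_eq_of_toTorus_eq {x x' : Fin 6 → ℝ} (h : toTorus x = toTorus x')
    (w : Fin 6 → ℝ) : nilPoint x w = nilPoint x' w := by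
  obtain ⟨k, rfl⟩ := toTorus_eq_iff.1 h
  exact (nilPoint_add_int x w k).symm

theorem continuous_nilPoint : Continuous fun p : (Fin 6 → ℝ) × (Fin 6 → ℝ) =>
    nilPoint p.1 p.2 :=
  continuous_quotient_mk'.comp (continuous_mk continuous_fst continuous_snd
    (continuous_fst.dotProduct continuous_snd).neg)

/-- The parametrization of the support of the measure by the seven-dimensional torus. -/
noncomputable def param (ξ : Fin 6 → ℂ) (t : BigTorus) : HeisNil 6 :=
  nilPoint (Function.surjInv surjective_toTorus (bigProj t)) (curve ξ (t none))

theorem param_eq (ξ : Fin 6 → ℂ) {t : BigTorus} {x : Fin 6 → ℝ} (h : toTorus x = bigProj t) :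
    param ξ t = nilPoint x (curve ξ (t none)) :=
  nilPoint_eq_of_toTorus_eq ((Function.surjInv_eq _ _).trans h.symm) _

/-- The section in the definition is not assumed continuous. Continuity is checked on `ℝ⁷`, where
the map has a formula without choices. -/
theorem continuous_param (ξ : Fin 6 → ℂ) : Continuous (param ξ) := by
  have hq : IsOpenQuotientMap (Pi.map fun _ : Option (Fin 6) => ((↑) : ℝ → UnitAddCircle)) :=
    IsOpenQuotientMap.piMap fun _ => QuotientAddGroup.isOpenQuotientMap_mk
  rw [← hq.continuous_comp_iff]
  have h : (param ξ ∘ Pi.map fun _ : Option (Fin 6) => ((↑) : ℝ → UnitAddCircle)) =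
      fun v => nilPoint (fun i => v (some i)) (curve ξ (v none : UnitAddCircle)) :=
    funext fun v => param_eq ξ rfl
  rw [h]
  have h1 : Continuous fun v : Option (Fin 6) → ℝ => fun i => v (some i) :=
    continuous_pi fun i => continuous_apply (some i)
  have h2 : Continuous fun v : Option (Fin 6) → ℝ => curve ξ (v none : UnitAddCircle) :=
    (continuous_curve ξ).comp ((AddCircle.continuous_mk' (1 : ℝ)).comp (continuous_apply none))
  exact continuous_nilPoint.comp (h1.prodMk h2)

theorem measurable_param (ξ : Fin 6 → ℂ) : Measurable (param ξ) := (continuous_param ξ).measurable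

/-- The invariant measure. -/
noncomputable def nilMeasure (ξ : Fin 6 → ℂ) : Measure (HeisNil 6) := volume.map (param ξ)

instance (ξ : Fin 6 → ℂ) : IsProbabilityMeasure (nilMeasure ξ) :=
  Measure.isProbabilityMeasure_map (measurable_param ξ).aemeasurable

theorem measurePreserving_param (ξ : Fin 6 → ℂ) :
    MeasurePreserving (param ξ) volume (nilMeasure ξ) :=
  ⟨measurable_param ξ, rfl⟩

/-- The action in the coordinates of the seven-dimensional torus. The angle belongs to `c⁻¹` because
`y` is acted on by the inverse matrix. -/
theorem onNil_param {ξ : Fin 6 → ℂ} {a : Multiplicative (ℤ × ℤ)} {c : ℂ} (hc : c ≠ 0)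
    (h : ξ ᵥ* toC (unitHom a : IntMat) = c • ξ) {β : UnitAddCircle}
    (hβ : (β.toCircle : ℂ) = c⁻¹) (t : BigTorus) :
    heisAction.onNil a (param ξ t) = param ξ (bigMap (unitHom a : IntMat) β t) := by
  obtain ⟨x, hx⟩ := surjective_toTorus (bigProj t)
  have hx' : toTorus (toR (unitHom a : IntMat) *ᵥ x) = bigProj (bigMap (unitHom a : IntMat) β t) := by
    rw [bigProj_bigMap, ← hx, torusMap_toTorus]
  rw [param_eq ξ hx, param_eq ξ hx', bigMap_none, ← curve_vecMul (eigen_inv' hc h) hβ]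
  change ((autMap (unitHom a) (Heis.mk x (curve ξ (t none)) (-(x ⬝ᵥ curve ξ (t none)))) : Heis 6) :
    HeisNil 6) = _
  rw [nilPoint, dotProduct_autMap]
  rfl

theorem measurePreserving_onNil {ξ : Fin 6 → ℂ} {a : Multiplicative (ℤ × ℤ)} {c : ℂ}
    (hc : ‖c‖ = 1) (h : ξ ᵥ* toC (unitHom a : IntMat) = c • ξ) :
    MeasurePreserving (heisAction.onNil a) (nilMeasure ξ) (nilMeasure ξ) := by
  obtain ⟨β, hβ⟩ := exists_toCircle_eq (c := c⁻¹) (by rw [norm_inv, hc, inv_one])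
  have hm : Measurable (heisAction.onNil a) := (heisAction.onNil a).continuous.measurable
  refine ⟨hm, ?_⟩
  have hc0 : c ≠ 0 := fun h0 => by simp [h0] at hc
  have h1 : heisAction.onNil a ∘ param ξ = param ξ ∘ bigMap (unitHom a : IntMat) β :=
    funext (onNil_param hc0 h hβ)
  have hbig := measurePreserving_bigMap (unitHom a) β
  rw [nilMeasure, Measure.map_map hm (measurable_param ξ), h1,
    ← Measure.map_map (measurable_param ξ) hbig.measurable, hbig.map_eq]

theorem isErgodicUnder_nilMeasure {ξ : Fin 6 → ℂ} {χ : Multiplicative (ℤ × ℤ) → ℂ}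
    (hχ : ∀ a, ‖χ a‖ = 1) (h : ∀ a, ξ ᵥ* toC (unitHom a : IntMat) = χ a • ξ)
    (hroot : ∀ m : ℤ, m ≠ 0 → ∀ n : ℤ, n ≠ 0 → χ (Multiplicative.ofAdd (m, 0)) ^ n ≠ 1)
    {S : Subgroup (Multiplicative (ℤ × ℤ))} (hS : S.FiniteIndex) :
    IsErgodicUnder heisAction.onNil S (nilMeasure ξ) := by
  refine ⟨fun a _ => measurePreserving_onNil (hχ a) (h a), fun s hs hinv => ?_⟩
  obtain ⟨m, hm, hmS⟩ := exists_pow_fst_mem hS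
  set a : Multiplicative (ℤ × ℤ) := Multiplicative.ofAdd ((m : ℤ), (0 : ℤ))
  obtain ⟨β, hβ⟩ := exists_toCircle_eq (c := (χ a)⁻¹) (by rw [norm_inv, hχ, inv_one])
  have hc0 : χ a ≠ 0 := fun h0 => by simpa [h0] using hχ a
  have h1 : bigMap (unitHom a : IntMat) β ⁻¹' (param ξ ⁻¹' s) =ᵐ[volume] param ξ ⁻¹' s := by
    have h2 := (measurePreserving_param ξ).quasiMeasurePreserving.preimage_ae_eq (hinv a hmS)
    have h3 : param ξ ⁻¹' (heisAction.onNil a ⁻¹' s) =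
        bigMap (unitHom a : IntMat) β ⁻¹' (param ξ ⁻¹' s) := by
      ext t
      simp only [Set.mem_preimage, onNil_param hc0 (h a) hβ]
    rwa [h3] at h2
  have hirr : ∀ n : ℤ, n ≠ 0 → n • β ≠ 0 := fun n hn h0 => by
    have h4 : ((n • β).toCircle : ℂ) = 1 := by rw [h0]; simp
    rw [AddCircle.toCircle_zsmul, Circle.coe_zpow, hβ, _root_.inv_zpow, inv_eq_one] at h4
    exact hroot m (by exact_mod_cast hm) n hn h4
  have h5 := measure_zero_or_compl_of_bigMap hm hirr (measurable_param ξ hs) h1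
  rwa [← Set.preimage_compl, (measurePreserving_param ξ).measure_preimage hs.nullMeasurableSet,
    (measurePreserving_param ξ).measure_preimage hs.compl.nullMeasurableSet] at h5

theorem map_factor_nilMeasure (ξ : Fin 6 → ℂ) :
    (nilMeasure ξ).map (fun p => baseHomeo (factorMap (lattice 6) (vertical 6) p)) = volume := by
  have hcont : Continuous fun p => baseHomeo (factorMap (lattice 6) (vertical 6) p) :=
    baseHomeo.continuous.comp (continuous_quotient_mk'.quotient_lift _)
  have h : (fun p => baseHomeo (factorMap (lattice 6) (vertical 6) p)) ∘ param ξ = bigProj := by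
    funext t
    obtain ⟨x, hx⟩ := surjective_toTorus (bigProj t)
    rw [Function.comp_apply, param_eq ξ hx, ← hx]
    rfl
  rw [nilMeasure, Measure.map_map hcont.measurable (measurable_param ξ), h,
    measurePreserving_bigProj.map_eq]

/-! ### The measure is not fibred over compact orbits -/

/-- The preimage in the group of the support of the measure. -/
def supportSet (ξ : Fin 6 → ℂ) : Set (Heis 6) :=
  {g | ∃ θ, toTorus (g.y - curve ξ θ) = 0 ∧
    ((g.z - g.x ⬝ᵥ g.y + 2 * (g.x ⬝ᵥ curve ξ θ) : ℝ) : UnitAddCircle) = 0}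

/-- Projection along the compact circle of the parameters `θ` is a closed map. -/
theorem isClosed_supportSet (ξ : Fin 6 → ℂ) : IsClosed (supportSet ξ) := by
  have hx : Continuous fun p : UnitAddCircle × Heis 6 => p.2.x := continuous_x.comp continuous_snd
  have hy : Continuous fun p : UnitAddCircle × Heis 6 => p.2.y := continuous_y.comp continuous_snd
  have hz : Continuous fun p : UnitAddCircle × Heis 6 => p.2.z := continuous_z.comp continuous_snd
  have hw : Continuous fun p : UnitAddCircle × Heis 6 => curve ξ p.1 :=
    (continuous_curve ξ).comp continuous_fst
  have h1 : IsClosed {p : UnitAddCircle × Heis 6 | toTorus (p.2.y - curve ξ p.1) = 0} :=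
    isClosed_eq (continuous_toTorus.comp (hy.sub hw)) continuous_const
  have h2 : IsClosed {p : UnitAddCircle × Heis 6 | ((p.2.z - p.2.x ⬝ᵥ p.2.y +
      2 * (p.2.x ⬝ᵥ curve ξ p.1) : ℝ) : UnitAddCircle) = 0} :=
    isClosed_eq ((AddCircle.continuous_mk' (1 : ℝ)).comp ((hz.sub (hx.dotProduct hy)).add
      (continuous_const.mul (hx.dotProduct hw)))) continuous_const
  convert isClosedMap_snd_of_compactSpace _ (h1.inter h2)
  ext g
  constructor
  · rintro ⟨θ, hθ⟩
    exact ⟨(θ, g), hθ, rfl⟩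
  · rintro ⟨⟨θ, g⟩, hθ, rfl⟩
    exact ⟨θ, hθ⟩

/-- If `y = w(θ) + q` with `q` integral, right multiplication by `(k, l, m)` changes `z - x·y + 2
x·w(θ)` by the integer `m - 2 k·q - k·l`. -/
theorem mul_mem_supportSet {ξ : Fin 6 → ℂ} {g γ : Heis 6} (hg : g ∈ supportSet ξ)
    (hγ : γ ∈ lattice 6) : g * γ ∈ supportSet ξ := by
  obtain ⟨θ, h1, h2⟩ := hg
  obtain ⟨k, l, m, rfl⟩ := mem_lattice_iff.1 hγ
  obtain ⟨q, hq⟩ := toTorus_eq_zero_iff.1 h1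
  have hy : g.y = curve ξ θ + fun i => (q i : ℝ) := by rw [← hq]; abel
  refine ⟨θ, toTorus_eq_zero_iff.2 ⟨q + l, ?_⟩, ?_⟩
  · funext i
    simp only [mul_y, mk_y, hy, Pi.add_apply, Pi.sub_apply, Int.cast_add]
    ring
  · obtain ⟨j, hj⟩ := (AddCircle.coe_eq_zero_iff (1 : ℝ)).1 h2
    refine (AddCircle.coe_eq_zero_iff (1 : ℝ)).2
      ⟨j + m - 2 * (∑ i, k i * q i) - ∑ i, k i * l i, ?_⟩
    have e1 : (∑ i, (k i : ℝ) * q i) = (fun i => (k i : ℝ)) ⬝ᵥ fun i => (q i : ℝ) := rfl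
    have e2 : (∑ i, (k i : ℝ) * l i) = (fun i => (k i : ℝ)) ⬝ᵥ fun i => (l i : ℝ) := rfl
    rw [zsmul_eq_mul, mul_one] at hj ⊢
    push_cast
    rw [hj, e1, e2]
    simp only [mul_x, mul_y, mul_z, mk_x, mk_y, mk_z, hy, add_dotProduct, dotProduct_add]
    ring

/-- The support of the measure. -/
def nilSupport (ξ : Fin 6 → ℂ) : Set (HeisNil 6) :=
  ((↑) : Heis 6 → HeisNil 6) '' supportSet ξ

theorem mk_mem_nilSupport {ξ : Fin 6 → ℂ} {g : Heis 6} :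
    (g : HeisNil 6) ∈ nilSupport ξ ↔ g ∈ supportSet ξ := by
  refine ⟨?_, fun h => ⟨g, h, rfl⟩⟩
  rintro ⟨k, hk, e⟩
  have := mul_mem_supportSet hk (QuotientGroup.eq.1 e)
  rwa [mul_inv_cancel_left] at this

theorem isClosed_nilSupport (ξ : Fin 6 → ℂ) : IsClosed (nilSupport ξ) := by
  rw [← (QuotientGroup.isQuotientMap_mk (lattice 6)).isClosed_preimage]
  convert isClosed_supportSet ξ
  ext g
  exact mk_mem_nilSupport

theorem param_mem_nilSupport (ξ : Fin 6 → ℂ) (t : BigTorus) : param ξ t ∈ nilSupport ξ := by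
  refine mk_mem_nilSupport.2 ⟨t none, ?_, ?_⟩
  · rw [mk_y, sub_self (curve ξ (t none))]; rfl
  · simp only [mk_x, mk_y, mk_z]
    rw [show ∀ r : ℝ, -r - r + 2 * r = 0 from fun r => by ring]
    rfl

/-- An element that preserves the measure maps the support into itself. -/
theorem smul_param_mem_nilSupport {ξ : Fin 6 → ℂ} {h : Heis 6}
    (hh : (nilMeasure ξ).map (fun p => h • p) = nilMeasure ξ) (t : BigTorus) :
    h • param ξ t ∈ nilSupport ξ := by
  have hcont : Continuous fun p : HeisNil 6 => h • p := continuous_const_smul h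
  have hopen : IsOpen ((fun t => h • param ξ t) ⁻¹' (nilSupport ξ)ᶜ) :=
    (isClosed_nilSupport ξ).isOpen_compl.preimage (hcont.comp (continuous_param ξ))
  have hmeas : MeasurableSet (nilSupport ξ)ᶜ := (isClosed_nilSupport ξ).isOpen_compl.measurableSet
  have h0 : nilMeasure ξ (nilSupport ξ)ᶜ = 0 := by
    rw [nilMeasure, Measure.map_apply (measurable_param ξ) hmeas]
    convert measure_empty (μ := (volume : Measure BigTorus))
    exact Set.eq_empty_of_forall_notMem fun t ht => ht (param_mem_nilSupport ξ t)
  have h1 : volume ((fun t => h • param ξ t) ⁻¹' (nilSupport ξ)ᶜ) = 0 := by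
    rw [← hh, Measure.map_apply hcont.measurable hmeas, nilMeasure,
      Measure.map_apply (measurable_param ξ) (hcont.measurable hmeas)] at h0
    exact h0
  -- An open null set for Haar measure is empty, which upgrades almost every `t` to every `t`.
  have h2 := (hopen.measure_eq_zero_iff volume).1 h1
  by_contra hcon
  have : t ∈ (fun t => h • param ξ t) ⁻¹' (nilSupport ξ)ᶜ := hcon
  rw [h2] at this
  exact this

/-- The form of an element that preserves the measure. -/
theorem exists_of_map_smul_eq {ξ : Fin 6 → ℂ} {h : Heis 6}
    (hh : (nilMeasure ξ).map (fun p => h • p) = nilMeasure ξ) (θ : UnitAddCircle) :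
    ∃ θ', (∃ q : Fin 6 → ℤ, h.y + curve ξ θ - curve ξ θ' = fun i => (q i : ℝ)) ∧
      ∃ m : ℤ, h.z - h.x ⬝ᵥ h.y + 2 * (h.x ⬝ᵥ curve ξ θ') = m := by
  -- The points of the support with `x = 0` already give enough information.
  have h1 := smul_param_mem_nilSupport hh (fun o => o.elim θ 0)
  rw [param_eq ξ (x := 0) rfl] at h1
  have h2 : (h * Heis.mk 0 (curve ξ θ) 0 : Heis 6) ∈ supportSet ξ := by
    rw [← mk_mem_nilSupport]
    convert h1
    rw [nilPoint, zero_dotProduct, neg_zero]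
    rfl
  obtain ⟨θ', h3, h4⟩ := h2
  refine ⟨θ', toTorus_eq_zero_iff.1 h3, ?_⟩
  obtain ⟨m, hm⟩ := (AddCircle.coe_eq_zero_iff (1 : ℝ)).1 h4
  refine ⟨m, ?_⟩
  simp only [mul_x, mul_y, mul_z, mk_x, mk_y, mk_z, add_zero, zero_dotProduct, sub_zero,
    dotProduct_add] at hm
  simp only [zsmul_eq_mul, mul_one] at hm
  rw [hm]
  ring

/-- A continuous homomorphism from a connected subgroup to `ℝ` that avoids the value `1/2` is
trivial. -/
theorem eq_zero_of_ne_half {G : Type*} [Group G] [TopologicalSpace G] {H : Subgroup G}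
    (hH : IsConnected (H : Set G)) {φ : G → ℝ} (hφ : Continuous φ)
    (hadd : ∀ g ∈ H, ∀ h ∈ H, φ (g * h) = φ g + φ h) (hne : ∀ g ∈ H, φ g ≠ 1 / 2) :
    ∀ g ∈ H, φ g = 0 := by
  have h1 : φ 1 = 0 := by
    have := hadd 1 H.one_mem 1 H.one_mem
    rw [mul_one] at this
    linarith
  have hlt : ∀ g ∈ H, φ g < 1 / 2 := fun g hg => by
    by_contra! hcon
    -- A value of at least `1/2` would force the value `1/2`, and a positive value has powers that
    -- exceed `1/2`.
    obtain ⟨k, hk, hk2⟩ := hH.isPreconnected.intermediate_value H.one_mem hg hφ.continuousOn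
      (show (1 / 2 : ℝ) ∈ Set.Icc (φ 1) (φ g) from ⟨by rw [h1]; norm_num, hcon⟩)
    exact hne k hk hk2
  have hpow : ∀ g ∈ H, ∀ n : ℕ, φ (g ^ n) = n * φ g := fun g hg n => by
    induction n with
    | zero => simp [h1]
    | succ n ih => rw [pow_succ, hadd _ (H.pow_mem hg n) _ hg, ih]; push_cast; ring
  have hnonpos : ∀ g ∈ H, φ g ≤ 0 := fun g hg => by
    by_contra! hpos
    obtain ⟨n, hn⟩ := exists_nat_gt (1 / 2 / φ g)
    rw [div_lt_iff₀ hpos, ← hpow g hg] at hn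
    exact absurd (hlt _ (H.pow_mem hg n)) (not_lt.2 hn.le)
  intro g hg
  have h2 := hadd g hg g⁻¹ (H.inv_mem hg)
  rw [mul_inv_cancel, h1] at h2
  linarith [hnonpos g hg, hnonpos _ (H.inv_mem hg)]

theorem intCast_ne_half (m : ℤ) : (m : ℝ) ≠ 1 / 2 := fun h => by
  have : ((2 * m : ℤ) : ℝ) = (1 : ℤ) := by push_cast; linarith
  have := Int.cast_injective this
  omega

/-- A connected group of elements preserving the measure consists of elements `(x, 0, 0)` with `x`
orthogonal to the circle. -/
theorem eq_of_preserves_nilMeasure {ξ : Fin 6 → ℂ} (hξ : ∀ i, ‖ξ i‖ ≤ 1 / 8)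
    {H : Subgroup (Heis 6)} (hconn : IsConnected (H : Set (Heis 6)))
    (hH : ∀ h ∈ H, (nilMeasure ξ).map (fun p => h • p) = nilMeasure ξ) :
    ∀ h ∈ H, h.y = 0 ∧ h.z = 0 ∧ ∀ θ, h.x ⬝ᵥ curve ξ θ = 0 := by
  have hsmall := abs_curve_le hξ
  have hy : ∀ h ∈ H, h.y = 0 := by
    intro h hh
    funext i
    refine eq_zero_of_ne_half hconn (φ := fun g => g.y i) ((continuous_apply i).comp continuous_y)
      (fun g _ k _ => rfl) (fun g hg hg2 => ?_) h hh
    -- Two points of the circle differ by at most `1/4` in each coordinate, so `y i = 1/2` would put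
    -- an integer strictly between `0` and `1`.
    obtain ⟨θ', ⟨q, hq⟩, -⟩ := exists_of_map_smul_eq (hH g hg) 0
    have h1 := congrFun hq i
    simp only [Pi.add_apply, Pi.sub_apply, hg2] at h1
    have h2 := abs_le.1 (hsmall 0 i)
    have h3 := abs_le.1 (hsmall θ' i)
    have h4 : (0 : ℝ) < (q i : ℝ) := by linarith
    have h5 : (q i : ℝ) < 1 := by linarith
    have h6 : 0 < q i := by exact_mod_cast h4
    have h7 : q i < 1 := by exact_mod_cast h5
    omega
  -- With `y = 0` on `H`, this expression is additive there. Smallness of the circle gives `w(θ') =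
  -- w(θ)`, so its values are integers.
  have hθ : ∀ θ, ∀ h ∈ H, h.z + 2 * (h.x ⬝ᵥ curve ξ θ) = 0 := by
    intro θ
    refine eq_zero_of_ne_half hconn (φ := fun h => h.z + 2 * (h.x ⬝ᵥ curve ξ θ))
      (continuous_z.add (continuous_const.mul (continuous_x.dotProduct continuous_const)))
      (fun g hg k hk => ?_) (fun g hg => ?_)
    · simp only [mul_x, mul_z, hy g hg, hy k hk, dotProduct_zero, add_dotProduct]
      ring
    · obtain ⟨θ', ⟨q, hq⟩, m, hm⟩ := exists_of_map_smul_eq (hH g hg) θ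
      rw [hy g hg, zero_add] at hq
      have hw : curve ξ θ = curve ξ θ' := by
        funext i
        have h1 := congrFun hq i
        simp only [Pi.sub_apply] at h1
        have h2 := abs_le.1 (hsmall θ i)
        have h3 := abs_le.1 (hsmall θ' i)
        have h4 : (-1 : ℝ) < (q i : ℝ) := by linarith
        have h5 : (q i : ℝ) < 1 := by linarith
        have h6 : -1 < q i := by exact_mod_cast h4
        have h7 : q i < 1 := by exact_mod_cast h5
        have h8 : q i = 0 := by omega
        rw [h8, Int.cast_zero] at h1
        linarith
      rw [hy g hg, dotProduct_zero, sub_zero, ← hw] at hm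
      rw [hm]
      exact intCast_ne_half m
  intro h hh
  have hz : h.z = 0 := by
    -- The circle is symmetric about `0`; adding the equations at opposite points isolates `z`.
    obtain ⟨θ', e⟩ := exists_curve_eq_neg ξ 0
    have h1 := hθ 0 h hh
    have h2 := hθ θ' h hh
    rw [e, dotProduct_neg] at h2
    linarith
  refine ⟨hy h hh, hz, fun θ => ?_⟩
  have := hθ θ h hh
  rw [hz] at this
  linarith

/-- The two consequences of a disintegration that the argument needs: invariance integrates over the
fibres, and almost any fibre provides a compact orbit. -/
theorem DisintegratesOverCompactOrbits.map_smul {H : Subgroup (Heis 6)} {μ : Measure (HeisNil 6)}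
    (h : DisintegratesOverCompactOrbits H μ) :
    (∀ g ∈ H, μ.map (fun p => g • p) = μ) ∧
      ∃ p : HeisNil 6, IsCompact (MulAction.orbit H p) := by
  obtain ⟨Y, _, ν, κ, hν, hbind, hae⟩ := h
  constructor
  · intro g hg
    have hm : Measurable fun p : HeisNil 6 => g • p := (continuous_const_smul g).measurable
    refine Measure.ext fun s hs => ?_
    rw [Measure.map_apply hm hs, ← hbind, Measure.bind_apply (hm hs) κ.measurable.aemeasurable,
      Measure.bind_apply hs κ.measurable.aemeasurable]
    refine lintegral_congr_ae ?_
    filter_upwards [hae] with y hy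
    rw [← Measure.map_apply hm hs, hy.map_smul g hg]
  · obtain ⟨y, hy⟩ := hae.exists
    obtain ⟨p, hp, -⟩ := hy.orbit
    exact ⟨p, hp⟩

theorem not_disintegrates_nilMeasure {ξ : Fin 6 → ℂ} (hξ : ∀ i, ‖ξ i‖ ≤ 1 / 8) (hξ0 : ξ ≠ 0)
    {S : Subgroup (Multiplicative (ℤ × ℤ))} (hS : S.FiniteIndex) {H : Subgroup (Heis 6)}
    (hne : H ≠ ⊥) (hconn : IsConnected (H : Set (Heis 6)))
    (hinv : InvariantUnder heisAction.lift S H) :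
    ¬ DisintegratesOverCompactOrbits H (nilMeasure ξ) := by
  intro hdis
  obtain ⟨hH, p, hp⟩ := DisintegratesOverCompactOrbits.map_smul hdis
  have hform := eq_of_preserves_nilMeasure hξ hconn hH
  have hcont : Continuous fun g : Heis 6 => toTorus g.x := continuous_toTorus.comp continuous_x
  let T : AddSubgroup (Torus 6) :=
    { carrier := (fun g : Heis 6 => toTorus g.x) '' H
      zero_mem' := ⟨1, H.one_mem, rfl⟩
      add_mem' := by
        rintro _ _ ⟨g, hg, rfl⟩ ⟨h, hh, rfl⟩
        exact ⟨g * h, H.mul_mem hg hh, rfl⟩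
      neg_mem' := by
        rintro _ ⟨g, hg, rfl⟩
        exact ⟨g⁻¹, H.inv_mem hg, rfl⟩ }
  have hTconn : IsConnected (T : Set (Torus 6)) := hconn.image _ hcont.continuousOn
  -- Up to a translation, `T` is the projection of the compact orbit.
  have hTclosed : IsClosed (T : Set (Torus 6)) := by
    obtain ⟨g, rfl⟩ := QuotientGroup.mk_surjective p
    let f : HeisNil 6 → Torus 6 := fun p =>
      baseHomeo (factorMap (lattice 6) (vertical 6) p) - toTorus g.x
    have hf : Continuous f :=
      (baseHomeo.continuous.comp (continuous_quotient_mk'.quotient_lift _)).sub continuous_const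
    have himg : (T : Set (Torus 6)) = f '' MulAction.orbit H (g : HeisNil 6) := by
      have hfk : ∀ k : Heis 6, f ((k * g : Heis 6) : HeisNil 6) = toTorus k.x := fun k => by
        change toTorus (k.x + g.x) - toTorus g.x = _
        rw [toTorus_add, add_sub_cancel_right]
      ext t
      constructor
      · rintro ⟨k, hk, rfl⟩
        exact ⟨_, ⟨⟨k, hk⟩, rfl⟩, hfk k⟩
      · rintro ⟨_, ⟨k, rfl⟩, rfl⟩
        exact ⟨k, k.2, (hfk k).symm⟩
    rw [himg]
    exact (hp.image hf).isClosed
  obtain ⟨m, hm, hmS⟩ := exists_pow_fst_mem hS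
  have hTinv : ∀ t ∈ T, torusMap (unitHom (Multiplicative.ofAdd ((m : ℤ), (0 : ℤ))) : IntMat) t ∈ T := by
    rintro _ ⟨k, hk, rfl⟩
    refine ⟨_, (hinv _ hmS k).2 hk, ?_⟩
    exact (torusMap_toTorus _ _).symm
  rcases eq_bot_or_top_of_torusMap_mem hm hTclosed hTconn hTinv with hT | hT
  · refine hne ((Subgroup.eq_bot_iff_forall H).2 fun g hg => Heis.ext' ?_ (hform g hg).1
      (hform g hg).2.1)
    funext i
    refine eq_zero_of_ne_half hconn (φ := fun g => g.x i) ((continuous_apply i).comp continuous_x)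
      (fun g _ k _ => rfl) (fun k hk => ?_) g hg
    have h0 : toTorus k.x ∈ T := ⟨k, hk, rfl⟩
    rw [hT, AddSubgroup.mem_bot, toTorus_eq_zero_iff] at h0
    obtain ⟨q, hq⟩ := h0
    rw [hq]
    exact intCast_ne_half (q i)
  · obtain ⟨θ, i, hi⟩ := exists_curve_ne_zero hξ0
    -- If `T` is everything, each `x ∈ ℝ⁶` is an integer vector away from some `g.x`, `g ∈ H`, which
    -- is orthogonal to the nonzero vector `w(θ)`. So `x·w(θ)` takes only countably many values, yet
    -- it takes all real ones.
    have hsurj : Function.Surjective fun k : Fin 6 → ℤ => (fun i => (k i : ℝ)) ⬝ᵥ curve ξ θ := by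
      intro r
      set x : Fin 6 → ℝ := Pi.single i (r / curve ξ θ i)
      have hx : toTorus x ∈ T := hT ▸ AddSubgroup.mem_top _
      obtain ⟨g, hg, e⟩ := hx
      obtain ⟨k, hk⟩ := toTorus_eq_iff.1 e
      refine ⟨k, ?_⟩
      have h1 : x ⬝ᵥ curve ξ θ = r := by
        rw [single_dotProduct, div_mul_cancel₀ _ hi]
      rw [← h1, hk, add_dotProduct, (hform g hg).2.2 θ, zero_add]
    have : Countable ℝ := hsurj.countable
    exact Cardinal.not_countable_real Set.countable_univ

end HeisExample

/-! ### Normalization of the eigenvector and proof of the theorem -/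

namespace HeisExample

open Matrix

/-- The isometric eigenvector can be taken as small as needed. -/
theorem exists_small_isometric_eigenvector :
    ∃ (ξ : Fin 6 → ℂ) (χ : Multiplicative (ℤ × ℤ) → ℂ), ξ ≠ 0 ∧ (∀ i, ‖ξ i‖ ≤ 1 / 8) ∧
    (∀ a, ‖χ a‖ = 1) ∧ (∀ a, ξ ᵥ* toC (unitHom a : IntMat) = χ a • ξ) ∧
    ∀ m : ℤ, m ≠ 0 → ∀ n : ℤ, n ≠ 0 → χ (Multiplicative.ofAdd (m, 0)) ^ n ≠ 1 := by
  obtain ⟨ξ, χ, h0, h1, h2, h3⟩ := exists_isometric_eigenvector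
  have hpos : 0 < ‖ξ‖ := norm_pos_iff.2 h0
  refine ⟨((1 / (8 * ‖ξ‖) : ℝ) : ℂ) • ξ, χ, smul_ne_zero ?_ h0, fun i => ?_, h1, fun a => ?_, h3⟩
  · exact_mod_cast (by positivity : (1 / (8 * ‖ξ‖) : ℝ) ≠ 0)
  · rw [Pi.smul_apply, norm_smul, Complex.norm_real, Real.norm_of_nonneg (by positivity),
      div_mul_eq_mul_div, one_mul, div_le_div_iff₀ (by positivity) (by norm_num)]
    linarith [norm_le_pi_norm ξ i]
  · rw [smul_vecMul, h2, smul_comm]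

end HeisExample

theorem theorem1p5 :
    -- `G` is a simply connected nilpotent Lie group and `Γ` is a cocompact lattice in `G`
    (LieGroup 𝓘(ℝ, HeisSpace 6) ∞ (Heis 6) ∧ SimplyConnectedSpace (Heis 6) ∧
      Group.IsNilpotent (Heis 6) ∧ IsCocompactLattice (Heis.lattice 6)) ∧
    ∃ (α : NilAction (Multiplicative (ℤ × ℤ)) (Heis.lattice 6)) (μ : Measure (HeisNil 6)),
      α.HasNoVirtuallyCyclicFactor ∧
      IsProbabilityMeasure μ ∧
      (∀ a, MeasurePreserving (α.onNil a) μ μ) ∧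
      -- the factor on a torus
      (∃ (H : Subgroup (Heis 6)) (hH : α.IsFactorSubgroup H) (d : ℕ)
          (e : (Heis 6 ⧸ (H ⊔ Heis.lattice 6)) ≃ₜ Torus d),
        (∀ g h : Heis 6, e ((g * h : Heis 6) : Heis 6 ⧸ (H ⊔ Heis.lattice 6)) =
          e (g : Heis 6 ⧸ (H ⊔ Heis.lattice 6)) + e (h : Heis 6 ⧸ (H ⊔ Heis.lattice 6))) ∧
        IsTotallyIrreducible (transportAction e (α.factorAction hH)) ∧
        ¬ IsVirtuallyCyclic (α.factorAction hH) ∧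
        μ.map (fun p => e (factorMap (Heis.lattice 6) H p)) = volume) ∧
      -- ergodicity of the finite index subactions
      (∀ S : Subgroup (Multiplicative (ℤ × ℤ)), S.FiniteIndex →
        IsErgodicUnder α.onNil S μ) ∧
      -- no fibration into compact orbits
      (∀ S : Subgroup (Multiplicative (ℤ × ℤ)), S.FiniteIndex →
        ¬ ∃ H : Subgroup (Heis 6), H ≠ ⊥ ∧ IsClosed (H : Set (Heis 6)) ∧
          IsConnected (H : Set (Heis 6)) ∧ InvariantUnder α.lift S H ∧
          DisintegratesOverCompactOrbits H μ) := by
  obtain ⟨ξ, χ, hξ0, hξ, hχ, heig, hroot⟩ := HeisExample.exists_small_isometric_eigenvector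
  have hfac := HeisExample.hasNoVirtuallyCyclicFactor_heisAction
  refine ⟨⟨inferInstance, Heis.simplyConnectedSpace, Heis.isNilpotent,
    Heis.isCocompactLattice_lattice⟩, HeisExample.heisAction, HeisExample.nilMeasure ξ, hfac,
    inferInstance, fun a => HeisExample.measurePreserving_onNil (hχ a) (heig a),
    ⟨Heis.vertical 6, HeisExample.isFactorSubgroup_vertical, 6, HeisExample.baseHomeo,
      fun g h => ?_, HeisExample.isTotallyIrreducible_base, hfac _ _ fun htop => ?_,
      HeisExample.map_factor_nilMeasure ξ⟩,
    fun S hS => HeisExample.isErgodicUnder_nilMeasure hχ heig hroot hS, ?_⟩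
  · simp only [HeisExample.baseHomeo_mk, Heis.mul_x, HeisExample.toTorus_add]
  -- The torus factor is not the one-point factor, so it falls under the general statement on
  -- virtually cyclic factors.
  · have h1 : Heis.mk (fun _ => 1) 0 0 ∈ Heis.vertical 6 := htop ▸ Subgroup.mem_top _
    exact one_ne_zero (congrFun (Heis.mem_vertical.1 h1) 0)
  · rintro S hS ⟨H, hne, -, hconn, hinv, hdis⟩
    exact HeisExample.not_disintegrates_nilMeasure hξ hξ0 hS hne hconn hinv hdis
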